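/- **Setting.** Let $L\ge 1$ and let $n_0,\dots,n_L\ge 0$ be qubit numbers. Layer $j\in\{1,\dots,L\}$ maps operators on $n_{j-1}$ qubits to operators on $n_j$ qubits; put $d_{\rm in}^{(j)}=2^{n_{j-1}}$ and $d_{\rm out}^{(j)}=2^{n_j}$. A real weight matrix $W_j=(W_j(A,B))$, $A\in\{0,1,2,3\}^{n_j}$, $B\in\{0,1,2,3\}^{n_{j-1}}$, defines the layer $$\phi^{W_j}(\rho)=\frac{1}{\sqrt{d_{\rm in}^{(j)}d_{\rm out}^{(j)}}}\sum_{A,B}\Big(\delta_{A,0}\delta_{B,0}\sqrt{d_{\rm in}^{(j)}/d_{\rm out}^{(j)}}+W_j(A,B)\Big)\,\mathrm{Tr}(\sigma_B\rho)\,\sigma_A ,$$ where $\sigma_A$ are the Pauli strings ($\sigma_0=\mathbb I$). For each layer fix, independently of the data, a set $S_j$ of entries $(A,B)$, the free parameters of the layer, and put $\xi_j=|S_j|$, $\xi_{\max}=\max_j\xi_j$. The parameters $\vec w=(W_j)_{j=1}^L$ are *admissible* if every $W_j$ vanishes outside $S_j$ (so $\|W_j\|_0\le\xi_j$) and every $\phi^{W_j}$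 is a quantum channel (linear, completely positive, trace preserving). Let $x\mapsto\rho(x)$ be a measurable encoding of the inputs $x\in\mathcal X$ into density operators on $n_0$ qubits. The classes are the $K=2^{n_L}$ computational basis states of the output system, and $$f_{\vec w}(x)[k]=\mathrm{Tr}\big(|k\rangle\langle k|\,(\phi^{W_L}\circ\dots\circ\phi^{W_1})(\rho(x))\big).$$ For a probability distribution $\mathcal D$ on labelled examples let $L_\gamma(f)=\mathbb P_{(x,y)\sim\mathcal D}\big[f(x)[y]\le\gamma+\max_{k\ne y}f(x)[k]\big]$ (a maximum over no class is $-\infty$), and let $\hat L_\gamma(f)$ be the corresponding frequency on the training set. Write $\|W\|_{1,1}=\sum_{A,B}|W(A,B)|$, $\|W\|_F^2=\sum_{A,B}W(A,B)^2$, and $$F(C)=\sqrt{d_{\rm out}^{(L)}}\sum_{j=1}^L\frac1{\sqrt{d_{\rm in}^{(j)}}}\prod_{\ell=j+1}^L C_\ell ,\qquad \beta_{\rm PTM}=\sqrt{d_{\rm out}^{(L)}}\sum_{j=1}^L\frac1{\sqrt{d_{\rm in}^{(j)}}}\prod_{\ell=j+1}^L\|W_\ell\|_{1,1}.$$ **Theorem.**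 There is an absolute constant $c>0$ such that for every such model, every $\mathcal D$, $N\ge1$, $\gamma>0$ and $\delta\in(0,1)$, with probability at least $1-\delta$ over a training set of $N$ independent samples from $\mathcal D$, the following holds for all admissible $\vec w$ and all reals $C_1,\dots,C_L$ with $\|W_\ell\|_{1,1}\le C_\ell$ for every $\ell$: $$L_0(f_{\vec w})\le\hat L_\gamma(f_{\vec w})+c\,\sqrt{\frac{\beta_{\rm PTM}^2\,\xi_{\max}\ln\!\big(\sum_{j=1}^L2^{\xi_j}\big)\sum_{j=1}^L\|W_j\|_F^2+\ln\!\big(N\,\mathcal N/\delta\big)}{\gamma^2N}}\,,$$ where $$\mathcal N=\max\Big\{1,\;L\,\min\Big\{\frac{\gamma\sqrt N}{\sqrt{\sum_{j=1}^L\|W_j\|_F^2}},\,F(C)\Big\}\Big\}$$ (if all $W_j$ vanish, the inner minimum is read as $F(C)$). If the failure event is not measurable, the probability bound means that its outer measure is at most $\delta$. -/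

import Mathlib

open MeasureTheory
open scoped ComplexOrder

noncomputable section

namespace PTMModel

/-- Labels of the computational basis of `n` qubits; the Hilbert space has dimension `2 ^ n`. -/
abbrev Bits (n : ℕ) : Type := Fin n → Fin 2

/-- Labels `A ∈ {0,1,2,3}^n` of the `n`-qubit Pauli strings; `0` labels the identity. -/
abbrev PauliIdx (n : ℕ) : Type := Fin n → Fin 4

/-- Operators on the space of `n` qubits. -/
abbrev Op (n : ℕ) : Type := Matrix (Bits n) (Bits n) ℂ

/-- Dimension of the space of `n` qubits. -/
def dim (n : ℕ) : ℝ := 2 ^ n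

/-- The single-qubit Pauli matrices `I, X, Y, Z`. -/
def pauli : Fin 4 → Matrix (Fin 2) (Fin 2) ℂ :=
  ![1, !![0, 1; 1, 0], !![0, -Complex.I; Complex.I, 0], !![1, 0; 0, -1]]

/-- The Pauli string `σ_A = σ_{A_1} ⊗ ⋯ ⊗ σ_{A_n}`. -/
def pauliString {n : ℕ} (A : PauliIdx n) : Op n :=
  Matrix.of fun x y => ∏ i, pauli (A i) (x i) (y i)

/-- Density operators. -/
def IsDensity {n : ℕ} (ρ : Op n) : Prop := ρ.PosSemidef ∧ ρ.trace = 1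

/-- The map `id_k ⊗ Φ`: apply `Φ` to every block of a `k × k` block operator. -/
def ampliation {m n : ℕ} (k : ℕ) (Φ : Op m → Op n)
    (X : Matrix (Fin k × Bits m) (Fin k × Bits m) ℂ) :
    Matrix (Fin k × Bits n) (Fin k × Bits n) ℂ :=
  Matrix.of fun p q => Φ (Matrix.of fun x y => X (p.1, x) (q.1, y)) p.2 q.2

/-- Quantum channels: linear, completely positive and trace-preserving maps. -/
structure IsChannel {m n : ℕ} (Φ : Op m → Op n) : Prop where
  linear : IsLinearMap ℂ Φ
  completely_positive : ∀ (k : ℕ) (X : Matrix (Fin k × Bits m) (Fin k × Bits m) ℂ),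
    X.PosSemidef → (ampliation k Φ X).PosSemidef
  trace_preserving : ∀ X : Op m, (Φ X).trace = X.trace

/-- A weight matrix `W(A, B)` of a layer from `m` to `n` qubits. -/
abbrev Weight (m n : ℕ) : Type := Matrix (PauliIdx n) (PauliIdx m) ℝ

/-- The Pauli transfer matrix `R(A,B) = δ_{A,0} δ_{B,0} √(d_in / d_out) + W(A,B)`. -/
def transferMatrix {m n : ℕ} (W : Weight m n) : Weight m n :=
  Matrix.of fun A B => (if A = 0 ∧ B = 0 then √(dim m / dim n) else 0) + W A B

/-- The layer `φ^W(ρ) = (d_in d_out)^{-1/2} ∑_{A,B} R(A,B) Tr(σ_B ρ) σ_A`. -/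
def layer {m n : ℕ} (W : Weight m n) (ρ : Op m) : Op n :=
  ((1 / √(dim m * dim n) : ℝ) : ℂ) • ∑ A : PauliIdx n, ∑ B : PauliIdx m,
    ((transferMatrix W A B : ℂ) * (pauliString B * ρ).trace) • pauliString A

/-- Entrywise `1`-norm. -/
def norm11 {m n : ℕ} (W : Weight m n) : ℝ := ∑ A, ∑ B, |W A B|

/-- Squared Frobenius norm. -/
def frobSq {m n : ℕ} (W : Weight m n) : ℝ := ∑ A, ∑ B, W A B ^ 2

/-- Parameters of a layered model with `n j` qubits between the layers: layer `j` (counted from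
`0`) goes from `n j` to `n (j + 1)` qubits, so `d_in^{(j)} = 2 ^ n j` and
`d_out^{(j)} = 2 ^ n (j + 1)`. In an `L`-layer model only the layers `j < L` are used. -/
abbrev Params (n : ℕ → ℕ) : Type := ∀ j : ℕ, Weight (n j) (n (j + 1))

/-- Sparsity patterns: for each layer the finite set of entries that may be nonzero. -/
abbrev Pattern (n : ℕ → ℕ) : Type := ∀ j : ℕ, Finset (PauliIdx (n (j + 1)) × PauliIdx (n j))

/-- The state after the first `j` layers. -/
def stateAfter {n : ℕ → ℕ} (W : Params n) (ρ : Op (n 0)) : ∀ j : ℕ, Op (n j)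
  | 0 => ρ
  | j + 1 => layer (W j) (stateAfter W ρ j)

/-- The output `f_w(x)[k] = Tr(|k⟩⟨k| ρ_out(x))` of the `L`-layer model with encoding `ρ`. -/
def output {X : Type*} {n : ℕ → ℕ} (L : ℕ) (ρ : X → Op (n 0)) (W : Params n)
    (x : X) (k : Bits (n L)) : ℝ :=
  (Matrix.single k k (1 : ℂ) * stateAfter W (ρ x) L).trace.re

/-- The parameters are admissible: every layer is a quantum channel whose weight matrix is
supported in the pattern. -/
def Admissible {n : ℕ → ℕ} (L : ℕ) (S : Pattern n) (W : Params n) : Prop :=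
  ∀ j < L, IsChannel (layer (W j)) ∧ ∀ A B, W j A B ≠ 0 → (A, B) ∈ S j

/-- The event `f(x)[y] ≤ γ + max_{k ≠ y} f(x)[k]`, where a maximum over no class is `-∞`. -/
def MarginError {X Y : Type*} (γ : ℝ) (f : X → Y → ℝ) (p : X × Y) : Prop :=
  ∃ k, k ≠ p.2 ∧ f p.1 p.2 ≤ γ + f p.1 k

/-- With at least two classes, `MarginError` is the usual inequality with the maximum. -/
theorem marginError_iff {X Y : Type*} [Fintype Y] [DecidableEq Y] (γ : ℝ) (f : X → Y → ℝ)
    (p : X × Y) (h : (Finset.univ.erase p.2).Nonempty) :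
    MarginError γ f p ↔ f p.1 p.2 ≤ γ + (Finset.univ.erase p.2).sup' h (f p.1) := by
  rw [← sub_le_iff_le_add', Finset.le_sup'_iff]
  simp [MarginError, add_comm]

/-- The expected margin loss `L_γ(f)`. -/
def marginLoss {X Y : Type*} [MeasurableSpace X] [MeasurableSpace Y] (D : Measure (X × Y))
    (γ : ℝ) (f : X → Y → ℝ) : ℝ :=
  D.real {p | MarginError γ f p}

open Classical in
/-- The empirical margin loss on the sample `s`. -/
def empMarginLoss {X Y : Type*} {N : ℕ} (s : Fin N → X × Y) (γ : ℝ) (f : X → Y → ℝ) : ℝ :=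
  (∑ i, if MarginError γ f (s i) then (1 : ℝ) else 0) / N

/-- `√d_out^{(L)} ∑_j (1 / √d_in^{(j)}) ∏_{ℓ > j} C_ℓ`. -/
def F (n : ℕ → ℕ) (L : ℕ) (C : ℕ → ℝ) : ℝ :=
  √(dim (n L)) * ∑ j ∈ Finset.range L, 1 / √(dim (n j)) * ∏ l ∈ Finset.Ico (j + 1) L, C l

/-- `β = √d_out^{(L)} ∑_j (1 / √d_in^{(j)}) ∏_{ℓ > j} ‖W_ℓ‖_{1,1}`. -/
def beta {n : ℕ → ℕ} (L : ℕ) (W : Params n) : ℝ := F n L fun l => norm11 (W l)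

/-- `∑_j ‖W_j‖_F²`. -/
def totalFrobSq {n : ℕ → ℕ} (L : ℕ) (W : Params n) : ℝ := ∑ j ∈ Finset.range L, frobSq (W j)

/-- `ξ_max`, the largest number of free entries in a layer. -/
def xiMax {n : ℕ → ℕ} (L : ℕ) (S : Pattern n) : ℕ := (Finset.range L).sup fun j => (S j).card

/-- The main complexity term `β² ξ_max ln(∑_j 2^{ξ_j}) ∑_j ‖W_j‖_F²`. -/
def complexity {n : ℕ → ℕ} (L : ℕ) (S : Pattern n) (W : Params n) : ℝ :=
  beta L W ^ 2 * xiMax L S * Real.log (∑ j ∈ Finset.range L, (2 : ℝ) ^ (S j).card)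
    * totalFrobSq L W

/-- `min {γ √N / √(∑_j ‖W_j‖_F²), F(C)}`, which is `F(C)` if all the weights vanish. -/
def betaCap {n : ℕ → ℕ} (L N : ℕ) (γ : ℝ) (W : Params n) (C : ℕ → ℝ) : ℝ :=
  if totalFrobSq L W = 0 then F n L C
  else min (γ * √N / √(totalFrobSq L W)) (F n L C)

/-- The size of the covering net, which has at least one element. -/
def netSize {n : ℕ → ℕ} (L N : ℕ) (γ : ℝ) (W : Params n) (C : ℕ → ℝ) : ℝ :=
  max 1 (L * betaCap L N γ W C)

end PTMModel

end

namespace PTMModel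

/-! The proof is a weighted union bound over a countable net of parameters, with a prior that makes
parameters of small Frobenius norm cheap.

Stability. In normalized Pauli coordinates (`pvec`) a layer is multiplication by its transfer
matrix. All states share the same identity coordinate, so the fixed entry of the transfer matrix
cancels in differences. In the ℓ¹ distance a layer therefore expands by at most `norm11 W`, and a
change of its weights adds at most `norm11 (V - W)` divided by `√d_in`. Iteration gives the
Lipschitz constant β (`abs_output_sub_le_mul_beta`).

Prior. With resolution τ of order γ/β, weights are rounded to multiples of `τ / ξ_max`, and a layer
of entrywise norm at most `τ / 2` becomes zero. An integer vector for a layer has prior weight 1 if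
it is zero, and otherwise θ times the product of `3 ^ (-|z|)`. For `θ = 1 / ∑ 2 ^ ξ_j` the total
mass is at most e. Both the number of nonzero layers and the size of the integers are controlled by
the Frobenius norms, so the negative log-weight is at most a constant times `ξ_max Λ ∑ ‖W_j‖_F² /
τ²`, where Λ is the logarithm of `∑ 2 ^ ξ_j` (`neg_log_latticeWeight_quant_le`).

Scale. The resolution depends on the unknown β, which has no a priori range. Let the gain of layer j
measure the influence on the output of the state entering it. Initial layers are replaced by zero
until every kept layer has gain above γ/8, which moves the outputs by at most γ/8 (`exists_trunc`).
Unless the bound is trivial, all gains are at most `√N`. Hence β of the truncated model, divided by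
the data-independent `ratioSum`, lies between γ/8 and N, and `N ^ 2 + 1` grid values determine it up
to a constant (`exists_scale`). The choices of truncation point and scale cost only `log L` and `log
(N ^ 2 + 1)`. The former is at most Λ and is absorbed by the complexity, so the logarithmic term
works with any number `M ≥ 1` in the place of the net size (`marginLoss_le_of_forall_net`). -/

/-! ### Algebra of Pauli strings. -/

theorem dim_pos (n : ℕ) : 0 < dim n := by unfold dim; positivity

theorem sqrt_dim_pos (n : ℕ) : 0 < √(dim n) := Real.sqrt_pos.2 (dim_pos n)

theorem one_le_sqrt_dim (n : ℕ) : 1 ≤ √(dim n) :=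
  Real.one_le_sqrt.2 (one_le_pow₀ (by norm_num))

/-- The matrix with entries `∏ i, M i (x i) (y i)`, i.e. the tensor product of the `M i`. -/
def tensor {n : ℕ} (M : Fin n → Matrix (Fin 2) (Fin 2) ℂ) : Op n :=
  Matrix.of fun x y => ∏ i, M i (x i) (y i)

theorem pauliString_eq_tensor {n : ℕ} (A : PauliIdx n) :
    pauliString A = tensor fun i => pauli (A i) := rfl

theorem tensor_mul {n : ℕ} (M M' : Fin n → Matrix (Fin 2) (Fin 2) ℂ) :
    tensor M * tensor M' = tensor fun i => M i * M' i := by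
  ext x y
  simp only [tensor, Matrix.mul_apply, Matrix.of_apply, Finset.prod_univ_sum,
    Fintype.piFinset_univ, Finset.prod_mul_distrib]

theorem trace_tensor {n : ℕ} (M : Fin n → Matrix (Fin 2) (Fin 2) ℂ) :
    (tensor M).trace = ∏ i, (M i).trace := by
  simp only [tensor, Matrix.trace, Matrix.diag, Matrix.of_apply, Finset.prod_univ_sum,
    Fintype.piFinset_univ]

theorem tensor_one {n : ℕ} : tensor (fun _ : Fin n => 1) = 1 := by
  ext x y
  simp only [tensor, Matrix.of_apply, Matrix.one_apply, Finset.prod_ite_zero, Finset.prod_const_one,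
    Finset.mem_univ, true_imp_iff, funext_iff]

theorem conjTranspose_tensor {n : ℕ} (M : Fin n → Matrix (Fin 2) (Fin 2) ℂ) :
    (tensor M).conjTranspose = tensor fun i => (M i).conjTranspose := by
  ext x y
  simp [tensor, Matrix.conjTranspose_apply]

theorem conjTranspose_pauli (a : Fin 4) : (pauli a).conjTranspose = pauli a := by
  fin_cases a <;> ext i j <;> fin_cases i <;> fin_cases j <;> simp [pauli]

theorem pauli_mul_self (a : Fin 4) : pauli a * pauli a = 1 := by
  fin_cases a <;> ext i j <;> fin_cases i <;> fin_cases j <;> simp [pauli, Matrix.mul_apply]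

theorem trace_pauli_mul (a b : Fin 4) :
    (pauli a * pauli b).trace = if a = b then 2 else 0 := by
  fin_cases a <;> fin_cases b <;>
    simp [pauli, Matrix.trace, Fin.sum_univ_two] <;> norm_num

theorem norm_pauli_le (a : Fin 4) (i j : Fin 2) : ‖pauli a i j‖ ≤ 1 := by
  fin_cases a <;> fin_cases i <;> fin_cases j <;> simp [pauli]

theorem conjTranspose_pauliString {n : ℕ} (A : PauliIdx n) :
    (pauliString A).conjTranspose = pauliString A := by
  simp [pauliString_eq_tensor, conjTranspose_tensor, conjTranspose_pauli]

theorem pauliString_mul_self {n : ℕ} (A : PauliIdx n) : pauliString A * pauliString A = 1 := by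
  simp only [pauliString_eq_tensor, tensor_mul, pauli_mul_self, tensor_one]

theorem pauliString_zero {n : ℕ} : pauliString (0 : PauliIdx n) = 1 := by
  rw [pauliString_eq_tensor, ← tensor_one]
  rfl

theorem trace_pauliString_mul {n : ℕ} (A B : PauliIdx n) :
    (pauliString A * pauliString B).trace = if A = B then ((dim n : ℝ) : ℂ) else 0 := by
  simp only [pauliString_eq_tensor, tensor_mul, trace_tensor, trace_pauli_mul,
    Finset.prod_ite_zero, Finset.mem_univ, true_imp_iff, funext_iff]
  simp [dim]

theorem norm_pauliString_le {n : ℕ} (A : PauliIdx n) (x y : Bits n) :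
    ‖pauliString A x y‖ ≤ 1 := by
  simp only [pauliString, Matrix.of_apply, norm_prod]
  exact Finset.prod_le_one (fun _ _ => norm_nonneg _) fun _ _ => norm_pauli_le _ _ _

theorem pauliString_diag_im {n : ℕ} (A : PauliIdx n) (x : Bits n) : (pauliString A x x).im = 0 := by
  have h := congrFun (congrFun (conjTranspose_pauliString A) x) x
  rw [Matrix.conjTranspose_apply] at h
  exact Complex.conj_eq_iff_im.1 h

/-! ### Pauli coordinates of states and the action of one layer. -/

/-- The normalized real Pauli coordinates `Re Tr(σ_B ρ) / √d`. -/
noncomputable def pvec {n : ℕ} (ρ : Op n) (B : PauliIdx n) : ℝ :=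
  (pauliString B * ρ).trace.re / √(dim n)

theorem pvec_zero {n : ℕ} {ρ : Op n} (h : IsDensity ρ) : pvec ρ 0 = 1 / √(dim n) := by
  simp [pvec, pauliString_zero, h.2]

theorem trace_conj_nonneg {n : ℕ} {ρ : Op n} (h : IsDensity ρ) (M : Op n) :
    0 ≤ (M * ρ * M.conjTranspose).trace.re := by
  have := (h.1.mul_mul_conjTranspose_same M).trace_nonneg
  exact (Complex.le_def.1 this).1

/-- Positivity of `(1 ± σ) ρ (1 ± σ)` together with `(1 ± σ)² = 2 (1 ± σ)` gives `|Re Tr(σρ)| ≤ 1`.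
-/
theorem abs_pvec_le {n : ℕ} {ρ : Op n} (h : IsDensity ρ) (B : PauliIdx n) :
    |pvec ρ B| ≤ 1 / √(dim n) := by
  rw [pvec, abs_div, abs_of_pos (sqrt_dim_pos n)]
  refine div_le_div_of_nonneg_right ?_ (sqrt_dim_pos n).le
  set σ := pauliString B
  have hσ : σ.conjTranspose = σ := conjTranspose_pauliString B
  have hσ2 : σ * σ = 1 := pauliString_mul_self B
  have e1 := trace_conj_nonneg h (1 - σ)
  have e2 := trace_conj_nonneg h (1 + σ)
  have t1 : ((1 - σ) * ρ * (1 - σ).conjTranspose).trace = 2 * ρ.trace - 2 * (σ * ρ).trace := by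
    rw [Matrix.conjTranspose_sub, hσ, Matrix.conjTranspose_one, Matrix.trace_mul_comm,
      ← Matrix.mul_assoc]
    have : (1 - σ) * (1 - σ) = (1 - σ) + (1 - σ) := by
      rw [sub_mul, mul_sub, mul_sub, hσ2]; simp only [one_mul, mul_one]; abel
    rw [this, add_mul, sub_mul, one_mul, Matrix.trace_add, Matrix.trace_sub]
    ring
  have t2 : ((1 + σ) * ρ * (1 + σ).conjTranspose).trace = 2 * ρ.trace + 2 * (σ * ρ).trace := by
    rw [Matrix.conjTranspose_add, hσ, Matrix.conjTranspose_one, Matrix.trace_mul_comm,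
      ← Matrix.mul_assoc]
    have : (1 + σ) * (1 + σ) = (1 + σ) + (1 + σ) := by
      rw [add_mul, mul_add, mul_add, hσ2]; simp only [one_mul, mul_one]; abel
    rw [this, add_mul, add_mul, one_mul, Matrix.trace_add, Matrix.trace_add]
    ring
  rw [t1, h.2] at e1
  rw [t2, h.2] at e2
  simp at e1 e2
  rw [abs_le]
  constructor <;> linarith

theorem trace_mul_layer {m n : ℕ} (W : Weight m n) (ρ : Op m) (A : PauliIdx n) :
    (pauliString A * layer W ρ).trace = ((1 / √(dim m * dim n) : ℝ) : ℂ) *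
      ∑ B, ((transferMatrix W A B : ℂ) * (pauliString B * ρ).trace) * ((dim n : ℝ) : ℂ) := by
  simp only [layer, Matrix.mul_smul, Matrix.trace_smul, Matrix.mul_sum, Matrix.trace_sum,
    trace_pauliString_mul, smul_eq_mul, mul_ite, mul_zero]
  congr 1
  rw [Finset.sum_comm]
  simp

/-- The factor `1 / √d` in `pvec` is the one that removes all dimension factors here. -/
theorem pvec_layer {m n : ℕ} (W : Weight m n) (ρ : Op m) (A : PauliIdx n) :
    pvec (layer W ρ) A = ∑ B, transferMatrix W A B * pvec ρ B := by
  have hm := sqrt_dim_pos m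
  have hn := sqrt_dim_pos n
  have hn2 : √(dim n) * √(dim n) = dim n := Real.mul_self_sqrt (dim_pos n).le
  simp only [pvec, trace_mul_layer, Complex.re_ofReal_mul, Complex.re_sum, Complex.re_mul_ofReal,
    Real.sqrt_mul (dim_pos m).le]
  rw [← Finset.sum_mul]
  have : ∀ B, transferMatrix W A B * ((pauliString B * ρ).trace.re / √(dim m)) =
      (transferMatrix W A B * (pauliString B * ρ).trace.re) / √(dim m) := fun B => by ring
  simp only [this, ← Finset.sum_div]
  nth_rw 2 [← hn2]
  field_simp

theorem layer_diag_re {m n : ℕ} (W : Weight m n) (ρ : Op m) (k : Bits n) :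
    (layer W ρ k k).re =
      (∑ A, pvec (layer W ρ) A * (pauliString A k k).re) / √(dim n) := by
  have hm := sqrt_dim_pos m
  have hn := sqrt_dim_pos n
  simp only [pvec_layer]
  simp only [pvec]
  rw [layer, Matrix.smul_apply, Matrix.sum_apply, smul_eq_mul, Complex.re_ofReal_mul,
    Complex.re_sum, Finset.mul_sum, Finset.sum_div, Real.sqrt_mul (dim_pos m).le]
  refine Finset.sum_congr rfl fun A _ => ?_
  rw [Matrix.sum_apply, Complex.re_sum, Finset.mul_sum, Finset.sum_mul, Finset.sum_div]
  refine Finset.sum_congr rfl fun B _ => ?_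
  rw [Matrix.smul_apply, smul_eq_mul, Complex.mul_re, pauliString_diag_im, Complex.re_ofReal_mul]
  field_simp
  ring

theorem output_eq {X : Type*} {n : ℕ → ℕ} (L : ℕ) (ρ : X → Op (n 0)) (W : Params n)
    (x : X) (k : Bits (n L)) : output L ρ W x k = (stateAfter W (ρ x) L k k).re := by
  rw [output, Matrix.trace_mul_comm, Matrix.trace_mul_single]
  simp

theorem abs_layer_diag_sub_le {m m' n : ℕ} (W : Weight m n) (V : Weight m' n) (ρ : Op m) (τ : Op m')
    (k : Bits n) : |(layer W ρ k k).re - (layer V τ k k).re| ≤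
      (∑ A, |pvec (layer W ρ) A - pvec (layer V τ) A|) / √(dim n) := by
  rw [layer_diag_re, layer_diag_re, ← sub_div, ← Finset.sum_sub_distrib, abs_div,
    abs_of_pos (sqrt_dim_pos n)]
  refine div_le_div_of_nonneg_right ?_ (sqrt_dim_pos n).le
  refine (Finset.abs_sum_le_sum_abs _ _).trans (Finset.sum_le_sum fun A _ => ?_)
  rw [← sub_mul, abs_mul]
  refine mul_le_of_le_one_right (abs_nonneg _) ?_
  exact (Complex.abs_re_le_norm _).trans (norm_pauliString_le A k k)

theorem IsChannel.map_isDensity {m n : ℕ} {Φ : Op m → Op n} (h : IsChannel Φ) {ρ : Op m}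
    (hρ : IsDensity ρ) : IsDensity (Φ ρ) := by
  refine ⟨?_, (h.trace_preserving ρ).trans hρ.2⟩
  -- Plain positivity is the case k = 1 of complete positivity, up to relabelling the basis.
  have h1 := h.completely_positive 1 (ρ.submatrix Prod.snd Prod.snd) (hρ.1.submatrix _)
  exact h1.submatrix fun x : Bits n => ((0 : Fin 1), x)

/-- Zero weights give the maximally mixed state for every input, so truncation stays within maps
that preserve density operators. -/
theorem layer_zero {m n : ℕ} (ρ : Op m) (h : IsDensity ρ) :
    layer (0 : Weight m n) ρ = ((1 / dim n : ℝ) : ℂ) • (1 : Op n) := by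
  have hm := dim_pos m
  have hn := dim_pos n
  have hs : 1 / √(dim m * dim n) * √(dim m / dim n) = 1 / dim n := by
    rw [Real.sqrt_mul hm.le, Real.sqrt_div hm.le]
    have hm' := sqrt_dim_pos m
    have hn' := sqrt_dim_pos n
    nth_rw 3 [← Real.mul_self_sqrt hn.le]
    field_simp
  have key : ∀ (A : PauliIdx n) (B : PauliIdx m),
      ((transferMatrix (0 : Weight m n) A B : ℂ) * (pauliString B * ρ).trace) • pauliString A =
      if A = 0 then (if B = 0 then ((√(dim m / dim n) : ℝ) : ℂ) • (1 : Op n) else 0) else 0 := by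
    intro A B
    by_cases hA : A = 0
    · by_cases hB : B = 0
      · subst hA hB
        simp [transferMatrix, pauliString_zero, h.2]
      · simp [transferMatrix, hB]
    · simp [transferMatrix, hA]
  simp only [layer, key]
  rw [Finset.sum_comm]
  simp only [Finset.sum_ite_eq', Finset.mem_univ, if_true]
  rw [smul_smul, ← Complex.ofReal_mul, hs]

theorem isDensity_layer_zero {m n : ℕ} {ρ : Op m} (h : IsDensity ρ) :
    IsDensity (layer (0 : Weight m n) ρ) := by
  have hn := dim_pos n
  rw [layer_zero ρ h]
  constructor
  · refine Matrix.PosSemidef.smul Matrix.PosSemidef.one ?_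
    exact_mod_cast (by positivity : (0 : ℝ) ≤ 1 / dim n)
  · rw [Matrix.trace_smul, Matrix.trace_one]
    simp only [Fintype.card_pi, Fintype.card_fin, Finset.prod_const, Finset.card_univ, smul_eq_mul]
    simp [dim]

theorem norm11_nonneg {m n : ℕ} (W : Weight m n) : 0 ≤ norm11 W :=
  Finset.sum_nonneg fun _ _ => Finset.sum_nonneg fun _ _ => abs_nonneg _

theorem frobSq_nonneg {m n : ℕ} (W : Weight m n) : 0 ≤ frobSq W :=
  Finset.sum_nonneg fun _ _ => Finset.sum_nonneg fun _ _ => sq_nonneg _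

theorem norm11_zero {m n : ℕ} : norm11 (0 : Weight m n) = 0 := by simp [norm11]

theorem frobSq_zero {m n : ℕ} : frobSq (0 : Weight m n) = 0 := by simp [frobSq]

/-- One layer is Lipschitz in the state (with respect to the Pauli coordinates) and in the
weights. -/
theorem sum_abs_pvec_layer_sub_le {m n : ℕ} (W V : Weight m n) {ρ τ : Op m}
    (hρ : IsDensity ρ) (hτ : IsDensity τ) :
    ∑ A, |pvec (layer W ρ) A - pvec (layer V τ) A| ≤
      norm11 W * ∑ B, |pvec ρ B - pvec τ B| + norm11 (V - W) * (1 / √(dim m)) := by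
  have h0 : pvec ρ 0 = pvec τ 0 := by rw [pvec_zero hρ, pvec_zero hτ]
  rw [norm11, norm11, Finset.sum_mul, Finset.sum_mul, ← Finset.sum_add_distrib]
  refine Finset.sum_le_sum fun A _ => ?_
  -- By `h0` the fixed entry of the transfer matrix cancels. The splitting puts `W` alone in front
  -- of the state difference, so the final constant is β of `W` and does not involve `V`.
  have key : pvec (layer W ρ) A - pvec (layer V τ) A =
      ∑ B, (W A B * (pvec ρ B - pvec τ B) - (V - W) A B * pvec τ B) := by
    rw [pvec_layer, pvec_layer, ← Finset.sum_sub_distrib]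
    refine Finset.sum_congr rfl fun B _ => ?_
    simp only [transferMatrix, Matrix.of_apply, Matrix.sub_apply]
    split_ifs with h
    · rw [h.2, h0]; ring
    · ring
  rw [key, Finset.sum_mul, Finset.sum_mul, ← Finset.sum_add_distrib]
  refine (Finset.abs_sum_le_sum_abs _ _).trans (Finset.sum_le_sum fun B _ => ?_)
  refine (abs_sub _ _).trans ?_
  rw [abs_mul, abs_mul]
  gcongr
  · exact Finset.single_le_sum (f := fun B => |pvec ρ B - pvec τ B|) (fun _ _ => abs_nonneg _)
      (Finset.mem_univ B)
  · exact abs_pvec_le hτ B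

/-! ### Propagation of perturbations, gains and truncation. -/

/-- Parameters supported in the pattern whose layers map density operators to density operators. -/
def DensityAdmissible {n : ℕ → ℕ} (L : ℕ) (S : Pattern n) (W : Params n) : Prop :=
  ∀ j < L, (∀ ρ, IsDensity ρ → IsDensity (layer (W j) ρ)) ∧ ∀ A B, W j A B ≠ 0 → (A, B) ∈ S j

theorem Admissible.densityAdmissible {n : ℕ → ℕ} {L : ℕ} {S : Pattern n} {W : Params n}
    (h : Admissible L S W) : DensityAdmissible L S W :=
  fun j hj => ⟨fun _ hρ => (h j hj).1.map_isDensity hρ, (h j hj).2⟩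

theorem DensityAdmissible.isDensity_stateAfter {n : ℕ → ℕ} {L : ℕ} {S : Pattern n} {W : Params n}
    (h : DensityAdmissible L S W) {ρ : Op (n 0)} (hρ : IsDensity ρ) :
    ∀ j ≤ L, IsDensity (stateAfter W ρ j)
  | 0, _ => hρ
  | j + 1, hj => (h j hj).1 _ (h.isDensity_stateAfter hρ j (by omega))

/-- The sum of the absolute differences of the Pauli coordinates after `m` layers. -/
noncomputable def gap {n : ℕ → ℕ} (W V : Params n) (ρ : Op (n 0)) (m : ℕ) : ℝ :=
  ∑ A, |pvec (stateAfter W ρ m) A - pvec (stateAfter V ρ m) A|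

theorem gap_succ_le {n : ℕ → ℕ} {L : ℕ} {S : Pattern n} {W V : Params n}
    (hW : DensityAdmissible L S W) (hV : DensityAdmissible L S V) {ρ : Op (n 0)}
    (hρ : IsDensity ρ) {j : ℕ} (hj : j < L) :
    gap W V ρ (j + 1) ≤ norm11 (W j) * gap W V ρ j + norm11 (V j - W j) * (1 / √(dim (n j))) :=
  sum_abs_pvec_layer_sub_le _ _ (hW.isDensity_stateAfter hρ j hj.le)
    (hV.isDensity_stateAfter hρ j hj.le)

/-- Unrolls the recursion of `gap_succ_le`. A general starting layer `J` is kept because truncation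
is compared from the middle of the model, while the Lipschitz bound starts at 0. -/
theorem gap_le {n : ℕ → ℕ} {L : ℕ} {S : Pattern n} {W V : Params n}
    (hW : DensityAdmissible L S W) (hV : DensityAdmissible L S V) {ρ : Op (n 0)}
    (hρ : IsDensity ρ) {J m : ℕ} (hJ : J ≤ m) (hm : m ≤ L) :
    gap W V ρ m ≤ (∏ l ∈ Finset.Ico J m, norm11 (W l)) * gap W V ρ J +
      ∑ j ∈ Finset.Ico J m, norm11 (V j - W j) * (1 / √(dim (n j))) *
        ∏ l ∈ Finset.Ico (j + 1) m, norm11 (W l) := by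
  induction m, hJ using Nat.le_induction with
  | base => simp
  | succ m hJ ih =>
    refine (gap_succ_le hW hV hρ hm).trans ?_
    have h1 := mul_le_mul_of_nonneg_left (ih (by omega)) (norm11_nonneg (W m))
    rw [Finset.prod_Ico_succ_top hJ, Finset.sum_Ico_succ_top hJ]
    have h2 : ∑ j ∈ Finset.Ico J m, norm11 (V j - W j) * (1 / √(dim (n j))) *
        ∏ l ∈ Finset.Ico (j + 1) (m + 1), norm11 (W l) =
        norm11 (W m) * ∑ j ∈ Finset.Ico J m, norm11 (V j - W j) * (1 / √(dim (n j))) *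
        ∏ l ∈ Finset.Ico (j + 1) m, norm11 (W l) := by
      rw [Finset.mul_sum]
      refine Finset.sum_congr rfl fun j hj => ?_
      rw [Finset.prod_Ico_succ_top (by have := Finset.mem_Ico.1 hj; omega)]
      ring
    rw [h2]
    simp only [Finset.Ico_self, Finset.prod_empty, mul_one]
    linarith

theorem abs_output_sub_le {X : Type*} {n : ℕ → ℕ} {L : ℕ} (hL : 0 < L) (ρ : X → Op (n 0))
    (W V : Params n) (x : X) (k : Bits (n L)) :
    |output L ρ W x k - output L ρ V x k| ≤ gap W V (ρ x) L / √(dim (n L)) := by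
  obtain ⟨L, rfl⟩ : ∃ l, L = l + 1 := ⟨L - 1, by omega⟩
  rw [output_eq, output_eq]
  exact abs_layer_diag_sub_le _ _ _ _ _

/-- Influence of the state before layer `j` on the output. -/
noncomputable def gain {n : ℕ → ℕ} (L : ℕ) (W : Params n) (j : ℕ) : ℝ :=
  √(dim (n L)) / √(dim (n j)) * ∏ l ∈ Finset.Ico j L, norm11 (W l)

theorem gain_nonneg {n : ℕ → ℕ} (L : ℕ) (W : Params n) (j : ℕ) : 0 ≤ gain L W j :=
  mul_nonneg (by positivity) (Finset.prod_nonneg fun _ _ => norm11_nonneg _)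

theorem gain_self {n : ℕ → ℕ} (L : ℕ) (W : Params n) : gain L W L = 1 := by
  simp [gain, (sqrt_dim_pos (n L)).ne']

/-- The ratio `√(d_out / d_in)` of layer `j`. -/
noncomputable def layerRatio (n : ℕ → ℕ) (j : ℕ) : ℝ := √(dim (n (j + 1))) / √(dim (n j))

theorem layerRatio_pos (n : ℕ → ℕ) (j : ℕ) : 0 < layerRatio n j :=
  div_pos (sqrt_dim_pos _) (sqrt_dim_pos _)

theorem beta_eq_sum_gain {n : ℕ → ℕ} (L : ℕ) (W : Params n) :
    beta L W = ∑ j ∈ Finset.range L, layerRatio n j * gain L W (j + 1) := by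
  rw [beta, F, Finset.mul_sum]
  refine Finset.sum_congr rfl fun j _ => ?_
  have := sqrt_dim_pos (n (j + 1))
  rw [layerRatio, gain]
  field_simp

theorem beta_nonneg {n : ℕ → ℕ} (L : ℕ) (W : Params n) : 0 ≤ beta L W := by
  rw [beta_eq_sum_gain]
  exact Finset.sum_nonneg fun j _ => mul_nonneg (layerRatio_pos n j).le (gain_nonneg _ _ _)

/-- The gain of layer `j` is `norm11 (W j)` times the single summand of β that belongs to `j`. -/
theorem gain_le_norm11_mul_beta {n : ℕ → ℕ} {L : ℕ} (W : Params n) {j : ℕ} (hj : j < L) :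
    gain L W j ≤ norm11 (W j) * beta L W := by
  have h1 : gain L W j = norm11 (W j) * (layerRatio n j * gain L W (j + 1)) := by
    have := sqrt_dim_pos (n (j + 1))
    rw [layerRatio, gain, gain, Finset.prod_eq_prod_Ico_succ_bot hj]
    field_simp
  rw [h1, beta_eq_sum_gain]
  refine mul_le_mul_of_nonneg_left ?_ (norm11_nonneg _)
  exact Finset.single_le_sum (f := fun j => layerRatio n j * gain L W (j + 1))
    (fun i _ => mul_nonneg (layerRatio_pos n i).le (gain_nonneg _ _ _)) (Finset.mem_range.2 hj)

/-- The outputs are Lipschitz in the weights with constant `β`. -/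
theorem abs_output_sub_le_mul_beta {X : Type*} {n : ℕ → ℕ} {L : ℕ} (hL : 0 < L) {S : Pattern n}
    {ρ : X → Op (n 0)} (hρ : ∀ x, IsDensity (ρ x)) {W V : Params n}
    (hW : DensityAdmissible L S W) (hV : DensityAdmissible L S V) {τ : ℝ}
    (hτ : ∀ j < L, norm11 (V j - W j) ≤ τ) (x : X) (k : Bits (n L)) :
    |output L ρ W x k - output L ρ V x k| ≤ τ * beta L W := by
  have hd := sqrt_dim_pos (n L)
  have hτ0 : 0 ≤ τ := (norm11_nonneg _).trans (hτ 0 hL)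
  refine (abs_output_sub_le hL ρ W V x k).trans ?_
  have h1 := gap_le hW hV (hρ x) (Nat.zero_le L) le_rfl
  have h2 : gap W V (ρ x) 0 = 0 := by simp [gap, stateAfter]
  rw [h2, mul_zero, zero_add, ← Finset.range_eq_Ico] at h1
  have h3 : gap W V (ρ x) L ≤ τ * (beta L W / √(dim (n L))) := by
    refine h1.trans ?_
    rw [beta, F, mul_comm (√(dim (n L))), mul_div_assoc, div_self hd.ne', mul_one,
      Finset.mul_sum]
    refine Finset.sum_le_sum fun j hj => ?_
    rw [mul_assoc]
    exact mul_le_mul_of_nonneg_right (hτ j (Finset.mem_range.1 hj))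
      (mul_nonneg (by positivity) (Finset.prod_nonneg fun _ _ => norm11_nonneg _))
  -- Two factors `1 / √d_out` are available, one from reading a diagonal entry and one left over
  -- from β; both are dropped.
  have h4 : beta L W / √(dim (n L)) ≤ beta L W :=
    div_le_self (beta_nonneg L W) (one_le_sqrt_dim _)
  have h5 : 0 ≤ gap W V (ρ x) L := Finset.sum_nonneg fun _ _ => abs_nonneg _
  exact (div_le_self h5 (one_le_sqrt_dim _)).trans (h3.trans (mul_le_mul_of_nonneg_left h4 hτ0))

/-- The parameters with the layers before `J` replaced by zero. -/
def trunc {n : ℕ → ℕ} (J : ℕ) (W : Params n) : Params n := fun j => if j < J then 0 else W j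

theorem DensityAdmissible.trunc {n : ℕ → ℕ} {L : ℕ} {S : Pattern n} {W : Params n}
    (h : DensityAdmissible L S W) (J : ℕ) : DensityAdmissible L S (trunc J W) := by
  intro j hj
  unfold PTMModel.trunc
  split_ifs
  · exact ⟨fun ρ hρ => isDensity_layer_zero hρ, fun A B hAB => absurd rfl hAB⟩
  · exact h j hj

theorem norm11_trunc_le {n : ℕ → ℕ} (J : ℕ) (W : Params n) (j : ℕ) :
    norm11 (trunc J W j) ≤ norm11 (W j) := by
  unfold trunc
  split_ifs
  · rw [norm11_zero]; exact norm11_nonneg _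
  · exact le_rfl

theorem frobSq_trunc_le {n : ℕ → ℕ} (J : ℕ) (W : Params n) (j : ℕ) :
    frobSq (trunc J W j) ≤ frobSq (W j) := by
  unfold trunc
  split_ifs
  · rw [frobSq_zero]; exact frobSq_nonneg _
  · exact le_rfl

theorem totalFrobSq_trunc_le {n : ℕ → ℕ} (L J : ℕ) (W : Params n) :
    totalFrobSq L (trunc J W) ≤ totalFrobSq L W :=
  Finset.sum_le_sum fun j _ => frobSq_trunc_le J W j

theorem gain_trunc_le {n : ℕ → ℕ} (L J : ℕ) (W : Params n) (j : ℕ) :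
    gain L (trunc J W) j ≤ gain L W j :=
  mul_le_mul_of_nonneg_left
    (Finset.prod_le_prod (fun _ _ => norm11_nonneg _) fun l _ => norm11_trunc_le J W l)
    (by positivity)

theorem beta_trunc_le {n : ℕ → ℕ} (L J : ℕ) (W : Params n) :
    beta L (trunc J W) ≤ beta L W := by
  rw [beta_eq_sum_gain, beta_eq_sum_gain]
  exact Finset.sum_le_sum fun j _ =>
    mul_le_mul_of_nonneg_left (gain_trunc_le L J W _) (layerRatio_pos n j).le

theorem gain_trunc_of_le {n : ℕ → ℕ} {L J : ℕ} (W : Params n) {j : ℕ} (h : J ≤ j) :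
    gain L (trunc J W) j = gain L W j := by
  unfold gain
  congr 1
  refine Finset.prod_congr rfl fun l hl => ?_
  rw [trunc, if_neg (by have := Finset.mem_Ico.1 hl; omega)]

theorem gain_trunc_of_lt {n : ℕ → ℕ} {L J : ℕ} (W : Params n) {j : ℕ} (h : j < J) (hJ : J ≤ L) :
    gain L (trunc J W) j = 0 := by
  unfold gain
  rw [Finset.prod_eq_zero (i := j) (Finset.mem_Ico.2 ⟨le_rfl, by omega⟩), mul_zero]
  rw [trunc, if_pos h, norm11_zero]

/-- The scale of `β` for parameters whose layers before `J` vanish. -/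
noncomputable def ratioSum (n : ℕ → ℕ) (L J : ℕ) : ℝ :=
  ∑ j ∈ Finset.range L, if J ≤ j + 1 then layerRatio n j else 0

theorem ratioSum_pos (n : ℕ → ℕ) {L J : ℕ} (hL : 0 < L) (hJ : J ≤ L) : 0 < ratioSum n L J := by
  refine Finset.sum_pos' (fun j _ => ?_) ⟨L - 1, Finset.mem_range.2 (by omega), ?_⟩
  · split_ifs
    exacts [(layerRatio_pos n j).le, le_rfl]
  · rw [if_pos (by omega)]
    exact layerRatio_pos n _

theorem mul_ratioSum_le_beta_trunc {n : ℕ → ℕ} {L J : ℕ} (W : Params n) {ε : ℝ}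
    (h : ∀ j, J ≤ j → j ≤ L → ε ≤ gain L W j) : ε * ratioSum n L J ≤ beta L (trunc J W) := by
  rw [beta_eq_sum_gain, ratioSum, Finset.mul_sum]
  refine Finset.sum_le_sum fun j hj => ?_
  have hj' := Finset.mem_range.1 hj
  -- Summand `j` of β contains the gain of layer `j + 1`. The summand of the last dropped layer, `j
  -- + 1 = J`, therefore survives truncation, which explains the condition `J ≤ j + 1` in
  -- `ratioSum`.
  split_ifs with hJ
  · rw [gain_trunc_of_le W hJ, mul_comm]
    exact mul_le_mul_of_nonneg_left (h _ hJ (by omega)) (layerRatio_pos n j).le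
  · rw [mul_zero]
    exact mul_nonneg (layerRatio_pos n j).le (gain_nonneg _ _ _)

theorem beta_trunc_le_mul_ratioSum {n : ℕ → ℕ} {L J : ℕ} (hJ : J ≤ L) (W : Params n) {M : ℝ}
    (h : ∀ j, j ≤ L → gain L W j ≤ M) : beta L (trunc J W) ≤ M * ratioSum n L J := by
  rw [beta_eq_sum_gain, ratioSum, Finset.mul_sum]
  refine Finset.sum_le_sum fun j hj => ?_
  have hj' := Finset.mem_range.1 hj
  split_ifs with hJj
  · rw [gain_trunc_of_le W hJj, mul_comm]
    exact mul_le_mul_of_nonneg_right (h _ (by omega)) (layerRatio_pos n j).le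
  · rw [gain_trunc_of_lt W (by omega) hJ, mul_zero, mul_zero]

/-- Dropping the layers before `J` changes the outputs by at most the gain of layer `J - 1`. -/
theorem abs_output_sub_trunc_le {X : Type*} {n : ℕ → ℕ} {L : ℕ} {S : Pattern n}
    {ρ : X → Op (n 0)} (hρ : ∀ x, IsDensity (ρ x)) {W : Params n}
    (hW : DensityAdmissible L S W) {J : ℕ} (hJ : J < L) (x : X) (k : Bits (n L)) :
    |output L ρ W x k - output L ρ (trunc (J + 1) W) x k| ≤ gain L W J := by
  have hd := sqrt_dim_pos (n L)
  have hV := hW.trunc (J + 1)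
  refine (abs_output_sub_le (by omega) ρ W _ x k).trans ?_
  have h5 : 0 ≤ gap W (trunc (J + 1) W) (ρ x) L := Finset.sum_nonneg fun _ _ => abs_nonneg _
  refine (div_le_self h5 (one_le_sqrt_dim _)).trans ?_
  have h1 := gap_le hW hV (hρ x) (Nat.succ_le_of_lt hJ) le_rfl
  have h2 : ∑ j ∈ Finset.Ico (J + 1) L, norm11 (trunc (J + 1) W j - W j) * (1 / √(dim (n j))) *
        ∏ l ∈ Finset.Ico (j + 1) L, norm11 (W l) = 0 := by
    refine Finset.sum_eq_zero fun j hj => ?_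
    rw [trunc, if_neg (by have := Finset.mem_Ico.1 hj; omega), sub_self, norm11_zero]
    simp
  rw [Nat.succ_eq_add_one, h2, add_zero] at h1
  have h3 : gap W (trunc (J + 1) W) (ρ x) (J + 1) ≤ norm11 (W J) * (1 / √(dim (n J))) := by
    have hr := hW.isDensity_stateAfter (hρ x) J hJ.le
    have hr' := hV.isDensity_stateAfter (hρ x) J hJ.le
    -- The difference is reversed so that the zero layer plays the role of the first weight in the
    -- one-layer estimate; the unknown distance of the incoming states is then multiplied by 0.
    have e : gap W (trunc (J + 1) W) (ρ x) (J + 1) =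
        ∑ A, |pvec (layer (0 : Weight (n J) (n (J + 1))) (stateAfter (trunc (J + 1) W) (ρ x) J)) A -
          pvec (layer (W J) (stateAfter W (ρ x) J)) A| := by
      refine Finset.sum_congr rfl fun A _ => ?_
      rw [abs_sub_comm]
      simp [stateAfter, trunc]
    rw [e]
    refine (sum_abs_pvec_layer_sub_le _ _ hr' hr).trans ?_
    rw [norm11_zero, zero_mul, zero_add, sub_zero]
  refine h1.trans ((mul_le_mul_of_nonneg_left h3
    (Finset.prod_nonneg fun _ _ => norm11_nonneg _)).trans ?_)
  rw [gain, Finset.prod_eq_prod_Ico_succ_bot hJ]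
  have hp : 0 ≤ (∏ l ∈ Finset.Ico (J + 1) L, norm11 (W l)) * (norm11 (W J) * (1 / √(dim (n J)))) :=
    mul_nonneg (Finset.prod_nonneg fun _ _ => norm11_nonneg _)
      (mul_nonneg (norm11_nonneg _) (by positivity))
  calc _ ≤ √(dim (n L)) * ((∏ l ∈ Finset.Ico (J + 1) L, norm11 (W l)) *
        (norm11 (W J) * (1 / √(dim (n J))))) := le_mul_of_one_le_left hp (one_le_sqrt_dim _)
    _ = _ := by ring

/-- If the last layer vanishes, all classes have the same output. -/
theorem output_trunc_self {X : Type*} {n : ℕ → ℕ} {L : ℕ} (hL : 0 < L) {S : Pattern n}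
    {ρ : X → Op (n 0)} (hρ : ∀ x, IsDensity (ρ x)) {W : Params n}
    (hW : DensityAdmissible L S W) (x : X) (k k' : Bits (n L)) :
    output L ρ (trunc L W) x k = output L ρ (trunc L W) x k' := by
  obtain ⟨L, rfl⟩ : ∃ l, L = l + 1 := ⟨L - 1, by omega⟩
  have h := (hW.trunc (L + 1)).isDensity_stateAfter (hρ x) L (by omega)
  have e : stateAfter (trunc (L + 1) W) (ρ x) (L + 1) =
      layer (0 : Weight (n L) (n (L + 1))) (stateAfter (trunc (L + 1) W) (ρ x) L) := by
    simp [stateAfter, trunc]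
  rw [output_eq, output_eq, e, layer_zero _ h]
  simp

theorem output_mem_Icc {X : Type*} {n : ℕ → ℕ} {L : ℕ} {S : Pattern n}
    {ρ : X → Op (n 0)} (hρ : ∀ x, IsDensity (ρ x)) {W : Params n}
    (hW : DensityAdmissible L S W) (x : X) (k : Bits (n L)) :
    output L ρ W x k ∈ Set.Icc (0 : ℝ) 1 := by
  have h := hW.isDensity_stateAfter (hρ x) L le_rfl
  rw [output_eq]
  have hn : ∀ i, 0 ≤ (stateAfter W (ρ x) L i i).re := fun i => (Complex.le_def.1 h.1.diag_nonneg).1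
  refine ⟨hn k, ?_⟩
  have ht := congrArg Complex.re h.2
  rw [Matrix.trace, Complex.re_sum, Complex.one_re] at ht
  rw [← ht]
  exact Finset.single_le_sum (f := fun i => (stateAfter W (ρ x) L i i).re)
    (fun i _ => hn i) (Finset.mem_univ k)

theorem measurable_stateAfter {X : Type*} [MeasurableSpace X] {n : ℕ → ℕ} {ρ : X → Op (n 0)}
    (hρ : ∀ a b, Measurable fun x => ρ x a b) (W : Params n) :
    ∀ j a b, Measurable fun x => stateAfter W (ρ x) j a b
  | 0, a, b => hρ a b
  | j + 1, a, b => by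
    have ih := measurable_stateAfter hρ W j
    simp only [stateAfter, layer, Matrix.smul_apply, Matrix.sum_apply, smul_eq_mul, Matrix.trace,
      Matrix.diag, Matrix.mul_apply]
    fun_prop

theorem measurable_output {X : Type*} [MeasurableSpace X] {n : ℕ → ℕ} {L : ℕ} {ρ : X → Op (n 0)}
    (hρ : ∀ a b, Measurable fun x => ρ x a b) (W : Params n) (k : Bits (n L)) :
    Measurable fun x => output L ρ W x k := by
  simp only [output_eq]
  exact Complex.measurable_re.comp (measurable_stateAfter hρ W L k k)

theorem measurableSet_marginError {X Y : Type*} [MeasurableSpace X] [MeasurableSpace Y]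
    [Countable Y] [MeasurableSingletonClass Y] {f : X → Y → ℝ} (hf : ∀ k, Measurable fun x => f x k)
    (γ : ℝ) : MeasurableSet {p : X × Y | MarginError γ f p} := by
  have hf' : Measurable fun p : X × Y => f p.1 p.2 := measurable_from_prod_countable_left hf
  simp only [MarginError, Set.ofPred_exists]
  refine MeasurableSet.iUnion fun k => ?_
  refine MeasurableSet.inter ((measurable_snd (measurableSet_singleton k).compl).congr ?_) ?_
  · ext p; exact not_congr eq_comm
  · exact measurableSet_le hf' (((hf k).comp measurable_fst).const_add γ)

/-! ### Concentration and the weighted union bound. -/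

/-- Hoeffding's inequality for the frequency of one event. -/
theorem measure_pi_freq_add_le {Ω : Type*} [MeasurableSpace Ω] (D : Measure Ω)
    [IsProbabilityMeasure D] {E : Set Ω} (hE : MeasurableSet E) {N : ℕ} (hN : 0 < N) {t : ℝ}
    (ht : 0 ≤ t) :
    Measure.pi (fun _ : Fin N => D)
      {s | (∑ i, E.indicator (fun _ => (1 : ℝ)) (s i)) / N + t ≤ D.real E} ≤
        ENNReal.ofReal (Real.exp (-(2 * N * t ^ 2))) := by
  have hN' : (0 : ℝ) < N := Nat.cast_pos.2 hN
  -- The sign turns a frequency that is too low into an upper deviation.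
  set Y : Ω → ℝ := fun ω => -E.indicator (fun _ => (1 : ℝ)) ω with hYdef
  have hY : Measurable Y := (measurable_const.indicator hE).neg
  have hint : ∫ ω, Y ω ∂D = -D.real E := by
    rw [integral_neg, integral_indicator_const _ hE]
    simp
  have hsub := ProbabilityTheory.hasSubgaussianMGF_of_mem_Icc (μ := D) (X := Y) (a := -1) (b := 0)
    hY.aemeasurable (Filter.Eventually.of_forall fun ω => by
      by_cases h : ω ∈ E <;> simp [hYdef, h])
  rw [hint] at hsub
  have hind := ProbabilityTheory.iIndepFun_pi (μ := fun _ : Fin N => D)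
    (X := fun _ ω => Y ω - -D.real E) (fun _ => (hY.sub_const _).aemeasurable)
  have hsub' : ∀ i ∈ (Finset.univ : Finset (Fin N)), ProbabilityTheory.HasSubgaussianMGF
      (fun s : Fin N → Ω => Y (s i) - -D.real E) ((‖(0 : ℝ) - -1‖₊ / 2) ^ 2)
      (Measure.pi fun _ : Fin N => D) := fun i _ => by
    refine ProbabilityTheory.HasSubgaussianMGF.of_map
      (Y := fun s : Fin N → Ω => s i) (X := fun ω => Y ω - -D.real E)
      (measurable_pi_apply i).aemeasurable ?_
    rw [(measurePreserving_eval (fun _ : Fin N => D) i).map_eq]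
    exact hsub
  have h := ProbabilityTheory.HasSubgaussianMGF.measure_sum_ge_le_of_iIndepFun hind hsub'
    (ε := N * t) (by positivity)
  have hexp : -(N * t) ^ 2 / (2 * ∑ i : Fin N, (((‖(0 : ℝ) - -1‖₊ / 2) ^ 2 : NNReal) : ℝ)) =
      -(2 * N * t ^ 2) := by
    simp
    field_simp
  rw [NNReal.coe_sum, hexp] at h
  rw [ENNReal.le_ofReal_iff_toReal_le (measure_ne_top _ _) (Real.exp_nonneg _)]
  refine (measureReal_mono fun s hs => ?_).trans h
  have hs' : (∑ i, E.indicator (fun _ => (1 : ℝ)) (s i)) / N + t ≤ D.real E := hs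
  have h2 : (∑ i, E.indicator (fun _ => (1 : ℝ)) (s i)) + N * t ≤ N * D.real E := by
    have := mul_le_mul_of_nonneg_left hs' hN'.le
    rw [mul_add, mul_div_cancel₀ _ hN'.ne'] at this
    exact this
  change N * t ≤ ∑ i, (Y (s i) - -D.real E)
  simp only [hYdef, Finset.sum_sub_distrib, Finset.sum_neg_distrib, Finset.sum_const,
    Finset.card_univ, Fintype.card_fin, nsmul_eq_mul]
  linarith

/-- Uniform convergence over a countable family of events with prior weights `w`. -/
theorem measure_pi_exists_freq_lt_le {Ω : Type*} [MeasurableSpace Ω] (D : Measure Ω)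
    [IsProbabilityMeasure D] {I : Type*} [Countable I] {E : I → Set Ω}
    (hE : ∀ i, MeasurableSet (E i)) {w : I → ℝ} (hw : ∀ i, 0 < w i)
    (hsum : ∑' i, ENNReal.ofReal (w i) ≤ 1) {N : ℕ} (hN : 0 < N) {δ : ℝ} (hδ : 0 < δ)
    (hδ1 : δ ≤ 1) :
    Measure.pi (fun _ : Fin N => D)
      {s | ∃ i, (∑ k, (E i).indicator (fun _ => (1 : ℝ)) (s k)) / N +
        √(Real.log (1 / (w i * δ)) / (2 * N)) < D.real (E i)} ≤ ENNReal.ofReal δ := by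
  have hN' : (0 : ℝ) < N := Nat.cast_pos.2 hN
  rw [Set.ofPred_exists]
  refine (measure_iUnion_le _).trans ?_
  have hi : ∀ i, Measure.pi (fun _ : Fin N => D)
      {s | (∑ k, (E i).indicator (fun _ => (1 : ℝ)) (s k)) / N +
        √(Real.log (1 / (w i * δ)) / (2 * N)) < D.real (E i)} ≤
      ENNReal.ofReal (w i) * ENNReal.ofReal δ := by
    intro i
    have hw1 : w i ≤ 1 := by
      have := (ENNReal.le_tsum (f := fun i => ENNReal.ofReal (w i)) i).trans hsum
      exact ENNReal.ofReal_le_one.1 this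
    have hpos : 0 < w i * δ := mul_pos (hw i) hδ
    have hle : w i * δ ≤ 1 := mul_le_one₀ hw1 hδ.le hδ1
    have hlog : 0 ≤ Real.log (1 / (w i * δ)) := Real.log_nonneg (one_le_one_div hpos hle)
    refine (measure_mono fun s hs => ?_).trans
      ((measure_pi_freq_add_le D (hE i) hN
        (Real.sqrt_nonneg (Real.log (1 / (w i * δ)) / (2 * N)))).trans (le_of_eq ?_))
    · have hs' : (∑ k, (E i).indicator (fun _ => (1 : ℝ)) (s k)) / N +
        √(Real.log (1 / (w i * δ)) / (2 * N)) < D.real (E i) := hs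
      exact hs'.le
    · rw [← ENNReal.ofReal_mul (hw i).le, Real.sq_sqrt (by positivity)]
      congr 1
      rw [mul_div_cancel₀ _ (by positivity), ← Real.log_inv, Real.exp_log (by positivity)]
      simp
  refine (ENNReal.tsum_le_tsum hi).trans ?_
  rw [ENNReal.tsum_mul_right]
  exact mul_le_of_le_one_left (zero_le) hsum

/-! ### A prior on families of integer vectors. -/

theorem hasSum_third_pow_natAbs : HasSum (fun z : ℤ => ((1 : ℝ) / 3) ^ z.natAbs) 2 := by
  have h : HasSum (fun n : ℕ => ((1 : ℝ) / 3) ^ n) (3 / 2) := by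
    have := hasSum_geometric_of_lt_one (r := (1 : ℝ) / 3) (by norm_num) (by norm_num)
    rwa [show ((1 : ℝ) - 1 / 3)⁻¹ = 3 / 2 by norm_num] at this
  set f : ℤ → ℝ := fun z => ((1 : ℝ) / 3) ^ z.natAbs with hf
  have h1 : HasSum (fun n : ℕ => f n) (3 / 2) := by simpa only [hf, Int.natAbs_natCast] using h
  have h2 : HasSum (fun n : ℕ => f (-((n : ℤ) + 1))) (3 / 2 * (1 / 3)) := by
    have e : ∀ n : ℕ, (-((n : ℤ) + 1)).natAbs = n + 1 := fun n => by omega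
    simpa only [hf, e, pow_succ] using h.mul_right (1 / 3)
  have h3 := HasSum.of_nat_of_neg_add_one h1 h2
  rwa [show (3 : ℝ) / 2 + 3 / 2 * (1 / 3) = 2 by norm_num] at h3

/-- The weight of a family of integer vectors: every nonzero vector costs a factor `θ` and every
entry `z` a factor `3 ^ (-|z|)`. -/
noncomputable def latticeWeight {κ : Type*} [Fintype κ] {ι : κ → Type*} [∀ j, Fintype (ι j)]
    (θ : ℝ) (z : ∀ j, ι j → ℤ) : ℝ :=
  open Classical in ∏ j, if z j = 0 then 1 else θ * ∏ i, ((1 : ℝ) / 3) ^ (z j i).natAbs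

theorem latticeWeight_pos {κ : Type*} [Fintype κ] {ι : κ → Type*} [∀ j, Fintype (ι j)]
    {θ : ℝ} (hθ : 0 < θ) (z : ∀ j, ι j → ℤ) : 0 < latticeWeight θ z := by
  refine Finset.prod_pos fun j _ => ?_
  split_ifs
  · exact one_pos
  · exact mul_pos hθ (Finset.prod_pos fun _ _ => by positivity)

/-- A finite set lies in a box, where the sum factors into one-dimensional sums, each at most 2. The
base 3 is chosen to make this total exactly 2, whence the powers `2 ^ ξ_j`. -/
theorem sum_prod_third_pow_le {ι : Type*} [Fintype ι] (s : Finset (ι → ℤ)) :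
    ∑ y ∈ s, ∏ i, ((1 : ℝ) / 3) ^ (y i).natAbs ≤ 2 ^ Fintype.card ι := by
  classical
  have hs : s ⊆ Fintype.piFinset fun i => s.image fun y => y i := fun y hy =>
    Fintype.mem_piFinset.2 fun i => Finset.mem_image_of_mem _ hy
  refine (Finset.sum_le_sum_of_subset_of_nonneg hs fun _ _ _ => by positivity).trans ?_
  rw [← Finset.prod_univ_sum (fun i => s.image fun y => y i)
    (fun _ z => ((1 : ℝ) / 3) ^ z.natAbs), ← Finset.card_univ, ← Finset.prod_const]
  refine Finset.prod_le_prod (fun _ _ => by positivity) fun i _ => ?_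
  exact sum_le_hasSum _ (fun _ _ => by positivity) hasSum_third_pow_natAbs

/-- The sum over a box again factors over the layers. Each factor is at most `1 + θ 2 ^ ξ_j`, and
the product is bounded by the exponential of the sum. -/
theorem sum_latticeWeight_le {κ : Type*} [Fintype κ] {ι : κ → Type*} [∀ j, Fintype (ι j)]
    {θ : ℝ} (hθ : 0 ≤ θ) (h : θ * ∑ j, (2 : ℝ) ^ Fintype.card (ι j) ≤ 1)
    (s : Finset (∀ j, ι j → ℤ)) : ∑ z ∈ s, latticeWeight θ z ≤ Real.exp 1 := by
  classical
  have hs : s ⊆ Fintype.piFinset fun j => s.image fun z => z j := fun z hz =>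
    Fintype.mem_piFinset.2 fun j => Finset.mem_image_of_mem _ hz
  have hnn : ∀ j (y : ι j → ℤ),
      0 ≤ if y = 0 then (1 : ℝ) else θ * ∏ i, ((1 : ℝ) / 3) ^ (y i).natAbs := fun j y => by
    split_ifs
    · exact zero_le_one
    · exact mul_nonneg hθ (Finset.prod_nonneg fun _ _ => by positivity)
  have hw : ∀ z : ∀ j, ι j → ℤ, latticeWeight θ z =
      ∏ j, if z j = 0 then (1 : ℝ) else θ * ∏ i, ((1 : ℝ) / 3) ^ (z j i).natAbs := fun z =>
    Finset.prod_congr rfl fun j _ => by congr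
  simp only [hw]
  refine (Finset.sum_le_sum_of_subset_of_nonneg hs fun z _ _ =>
    Finset.prod_nonneg fun j _ => hnn j _).trans ?_
  rw [← Finset.prod_univ_sum (fun j => s.image fun z => z j)
    (fun _ y => if y = 0 then (1 : ℝ) else θ * ∏ i, ((1 : ℝ) / 3) ^ (y i).natAbs)]
  have hj : ∀ j, ∑ y ∈ s.image (fun z => z j),
      (if y = 0 then (1 : ℝ) else θ * ∏ i, ((1 : ℝ) / 3) ^ (y i).natAbs) ≤
      1 + θ * 2 ^ Fintype.card (ι j) := by
    intro j
    calc _ ≤ ∑ y ∈ s.image (fun z => z j),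
          ((if y = 0 then (1 : ℝ) else 0) + θ * ∏ i, ((1 : ℝ) / 3) ^ (y i).natAbs) := by
            refine Finset.sum_le_sum fun y _ => ?_
            have : 0 ≤ θ * ∏ i, ((1 : ℝ) / 3) ^ (y i).natAbs :=
              mul_nonneg hθ (Finset.prod_nonneg fun _ _ => by positivity)
            split_ifs <;> linarith
      _ ≤ _ := by
            rw [Finset.sum_add_distrib, ← Finset.mul_sum]
            refine add_le_add ?_ (mul_le_mul_of_nonneg_left (sum_prod_third_pow_le _) hθ)
            rw [Finset.sum_ite_eq']
            split_ifs <;> norm_num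
  calc _ ≤ ∏ j, (1 + θ * 2 ^ Fintype.card (ι j)) :=
        Finset.prod_le_prod (fun j _ => Finset.sum_nonneg fun y _ => hnn j y) fun j _ => hj j
    _ ≤ Real.exp (∑ j, θ * 2 ^ Fintype.card (ι j)) :=
        Real.prod_one_add_le_exp_sum _ fun _ => by positivity
    _ ≤ _ := by
        rw [← Finset.mul_sum]
        exact Real.exp_le_exp.2 h

theorem tsum_latticeWeight_le {κ : Type*} [Fintype κ] {ι : κ → Type*} [∀ j, Fintype (ι j)]
    {θ : ℝ} (hθ : 0 < θ) (h : θ * ∑ j, (2 : ℝ) ^ Fintype.card (ι j) ≤ 1) :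
    ∑' z : ∀ j, ι j → ℤ, ENNReal.ofReal (latticeWeight θ z) ≤ ENNReal.ofReal (Real.exp 1) := by
  rw [ENNReal.tsum_eq_iSup_sum]
  refine iSup_le fun s => ?_
  rw [← ENNReal.ofReal_sum_of_nonneg fun z _ => (latticeWeight_pos hθ z).le]
  exact ENNReal.ofReal_le_ofReal (sum_latticeWeight_le hθ.le h s)

/-- The cost of a family of integer vectors in which the vectors and their entries are bounded by
squares. -/
theorem neg_log_latticeWeight_le {κ : Type*} [Fintype κ] {ι : κ → Type*} [∀ j, Fintype (ι j)]
    {θ : ℝ} (hθ : 0 < θ) (hθ1 : θ ≤ 1) (z : ∀ j, ι j → ℤ) (a : κ → ℝ) (ha : ∀ j, 0 ≤ a j)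
    (h1 : ∀ j, z j ≠ 0 → 1 ≤ a j) :
    -Real.log (latticeWeight θ z) ≤
      -Real.log θ * ∑ j, a j + 2 * ∑ j, ∑ i, ((z j i : ℤ) : ℝ) ^ 2 := by
  classical
  have hnn : 0 ≤ -Real.log θ := neg_nonneg.2 (Real.log_nonpos hθ.le hθ1)
  rw [latticeWeight, Real.log_prod fun j _ => by
      split_ifs
      · exact one_ne_zero
      · exact (mul_pos hθ (Finset.prod_pos fun _ _ => by positivity)).ne',
    ← Finset.sum_neg_distrib, Finset.mul_sum, Finset.mul_sum, ← Finset.sum_add_distrib]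
  refine Finset.sum_le_sum fun j _ => ?_
  have hsq : 0 ≤ ∑ i, ((z j i : ℤ) : ℝ) ^ 2 := Finset.sum_nonneg fun _ _ => sq_nonneg _
  split_ifs with hz
  · rw [Real.log_one, neg_zero]
    have := mul_nonneg hnn (ha j)
    positivity
  · rw [Real.log_mul hθ.ne' (Finset.prod_pos fun _ _ => by positivity).ne',
      Real.log_prod fun _ _ => by positivity, neg_add]
    refine add_le_add (le_mul_of_one_le_right hnn (h1 j hz)) ?_
    rw [← Finset.sum_neg_distrib, Finset.mul_sum]
    refine Finset.sum_le_sum fun i _ => ?_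
    rw [Real.log_pow, one_div, Real.log_inv]
    have hlog3 : Real.log 3 ≤ 2 := by
      have := Real.log_le_sub_one_of_pos (show (0 : ℝ) < 3 by norm_num)
      linarith
    have hlog3' : 0 ≤ Real.log 3 := Real.log_nonneg (by norm_num)
    -- For integers `|z| ≤ z²`; this converts the ℓ¹ cost into one governed by the Frobenius norm.
    have hz2 : ((z j i).natAbs : ℝ) ≤ ((z j i : ℤ) : ℝ) ^ 2 := by
      have : (((z j i).natAbs : ℤ)) ≤ (z j i) ^ 2 := by
        rw [← Int.natAbs_sq]
        exact_mod_cast Nat.le_self_pow two_ne_zero _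
      have h' : (((z j i).natAbs : ℤ) : ℝ) ≤ ((z j i ^ 2 : ℤ) : ℝ) := Int.cast_le.2 this
      rwa [Int.cast_natCast, Int.cast_pow] at h'
    have hn0 : (0 : ℝ) ≤ ((z j i).natAbs : ℝ) := Nat.cast_nonneg _
    nlinarith

/-! ### Rounding of the weights and its cost. -/

theorem sum_comp_eq_sum_pattern {m n : ℕ} {T : Finset (PauliIdx n × PauliIdx m)} {W : Weight m n}
    (hW : ∀ A B, W A B ≠ 0 → (A, B) ∈ T) {φ : ℝ → ℝ} (hφ : φ 0 = 0) :
    ∑ A, ∑ B, φ (W A B) = ∑ i : T, φ (W i.1.1 i.1.2) := by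
  rw [Finset.sum_coe_sort T fun i => φ (W i.1 i.2), ← Fintype.sum_prod_type']
  refine (Finset.sum_subset (Finset.subset_univ T) fun i _ hi => ?_).symm
  by_cases h : W i.1 i.2 = 0
  · rw [h, hφ]
  · exact absurd (hW _ _ h) hi

theorem norm11_eq_sum_pattern {m n : ℕ} {T : Finset (PauliIdx n × PauliIdx m)} {W : Weight m n}
    (hW : ∀ A B, W A B ≠ 0 → (A, B) ∈ T) : norm11 W = ∑ i : T, |W i.1.1 i.1.2| :=
  sum_comp_eq_sum_pattern hW abs_zero

theorem frobSq_eq_sum_pattern {m n : ℕ} {T : Finset (PauliIdx n × PauliIdx m)} {W : Weight m n}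
    (hW : ∀ A B, W A B ≠ 0 → (A, B) ∈ T) : frobSq W = ∑ i : T, W i.1.1 i.1.2 ^ 2 :=
  sum_comp_eq_sum_pattern (φ := fun x => x ^ 2) hW (by simp)

theorem norm11_sq_le {m n : ℕ} {T : Finset (PauliIdx n × PauliIdx m)} {W : Weight m n}
    (hW : ∀ A B, W A B ≠ 0 → (A, B) ∈ T) {ξ : ℝ} (hξ : (T.card : ℝ) ≤ ξ) :
    norm11 W ^ 2 ≤ ξ * frobSq W := by
  rw [norm11_eq_sum_pattern hW, frobSq_eq_sum_pattern hW]
  refine (sq_sum_le_card_mul_sum_sq (s := Finset.univ) (f := fun i : T => |W i.1.1 i.1.2|)).trans ?_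
  simp only [sq_abs, Finset.card_univ, Fintype.card_coe]
  exact mul_le_mul_of_nonneg_right hξ (Finset.sum_nonneg fun _ _ => sq_nonneg _)

theorem norm11_sub_le {m n : ℕ} (V W : Weight m n) : norm11 (V - W) ≤ norm11 V + norm11 W := by
  simp only [norm11, ← Finset.sum_add_distrib]
  exact Finset.sum_le_sum fun A _ => Finset.sum_le_sum fun B _ => abs_sub _ _

/-- Rounding of the weights of a layer to multiples of `τ / ξ`, where small layers are rounded
to zero. -/
noncomputable def quantLayer {m n : ℕ} (T : Finset (PauliIdx n × PauliIdx m)) (ξ τ : ℝ)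
    (W : Weight m n) : T → ℤ :=
  if norm11 W ≤ τ / 2 then 0 else fun i => round (W i.1.1 i.1.2 * ξ / τ)

section quantLayer

variable {m n : ℕ} {T : Finset (PauliIdx n × PauliIdx m)} {W : Weight m n} {ξ τ : ℝ}

/-- The code 0 can also arise when the layer is above the threshold but all entries round to 0; then
each is at most `τ / (2ξ)` and the same bound follows. -/
theorem norm11_le_of_quantLayer_eq_zero (hW : ∀ A B, W A B ≠ 0 → (A, B) ∈ T) (hτ : 0 < τ)
    (hξ0 : 0 < ξ) (hξ : (T.card : ℝ) ≤ ξ) (h : quantLayer T ξ τ W = 0) : norm11 W ≤ τ / 2 := by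
  by_contra hn
  rw [quantLayer, if_neg hn] at h
  refine hn ?_
  rw [norm11_eq_sum_pattern hW]
  have hi : ∀ i : T, |W i.1.1 i.1.2| ≤ τ / (2 * ξ) := by
    intro i
    have h1 := abs_sub_round (W i.1.1 i.1.2 * ξ / τ)
    rw [show round (W i.1.1 i.1.2 * ξ / τ) = 0 from congrFun h i, Int.cast_zero, sub_zero,
      abs_div, abs_mul, abs_of_pos hξ0, abs_of_pos hτ, div_le_iff₀ hτ] at h1
    rw [le_div_iff₀ (by positivity)]
    linarith
  refine (Finset.sum_le_sum fun i _ => hi i).trans ?_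
  rw [Finset.sum_const, Finset.card_univ, Fintype.card_coe, nsmul_eq_mul]
  calc (T.card : ℝ) * (τ / (2 * ξ)) ≤ ξ * (τ / (2 * ξ)) := by gcongr
    _ = τ / 2 := by field_simp

theorem norm11_sub_le_of_quantLayer_eq {V : Weight m n} (hV : ∀ A B, V A B ≠ 0 → (A, B) ∈ T)
    (hW : ∀ A B, W A B ≠ 0 → (A, B) ∈ T) (hτ : 0 < τ) (hξ0 : 0 < ξ) (hξ : (T.card : ℝ) ≤ ξ)
    (h : quantLayer T ξ τ V = quantLayer T ξ τ W) : norm11 (V - W) ≤ τ := by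
  by_cases h0 : quantLayer T ξ τ W = 0
  · have h1 := norm11_le_of_quantLayer_eq_zero hW hτ hξ0 hξ h0
    have h2 := norm11_le_of_quantLayer_eq_zero hV hτ hξ0 hξ (h.trans h0)
    linarith [norm11_sub_le V W]
  · have hWn : ¬ norm11 W ≤ τ / 2 := fun hn => h0 (by rw [quantLayer, if_pos hn])
    have hVn : ¬ norm11 V ≤ τ / 2 := fun hn => h0 (by rw [← h, quantLayer, if_pos hn])
    rw [quantLayer, quantLayer, if_neg hWn, if_neg hVn] at h
    have hD : ∀ A B, (V - W) A B ≠ 0 → (A, B) ∈ T := fun A B hAB => by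
      by_contra hT
      have h1 : V A B = 0 := by_contra fun hc => hT (hV _ _ hc)
      have h2 : W A B = 0 := by_contra fun hc => hT (hW _ _ hc)
      exact hAB (by rw [Matrix.sub_apply, h1, h2, sub_zero])
    rw [norm11_eq_sum_pattern hD]
    have hi : ∀ i : T, |(V - W) i.1.1 i.1.2| ≤ τ / ξ := by
      intro i
      have h1 := abs_sub_round (V i.1.1 i.1.2 * ξ / τ)
      have h2 := abs_sub_round (W i.1.1 i.1.2 * ξ / τ)
      rw [show round (V i.1.1 i.1.2 * ξ / τ) = round (W i.1.1 i.1.2 * ξ / τ) from congrFun h i]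
        at h1
      have h3 : |(V i.1.1 i.1.2 - W i.1.1 i.1.2) * ξ / τ| ≤ 1 := by
        rw [abs_le] at h1 h2 ⊢
        rw [sub_mul, sub_div]
        constructor <;> linarith [h1.1, h1.2, h2.1, h2.2]
      rw [abs_div, abs_mul, abs_of_pos hξ0, abs_of_pos hτ, div_le_iff₀ hτ] at h3
      rw [le_div_iff₀ hξ0, Matrix.sub_apply]
      linarith
    refine (Finset.sum_le_sum fun i _ => hi i).trans ?_
    rw [Finset.sum_const, Finset.card_univ, Fintype.card_coe, nsmul_eq_mul]
    calc (T.card : ℝ) * (τ / ξ) ≤ ξ * (τ / ξ) := by gcongr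
      _ = τ := by field_simp

/-- This is the purpose of the threshold: by Cauchy–Schwarz a layer above it has squared Frobenius
norm at least `τ² / (4ξ)`, so the total Frobenius norm limits the number of layers that pay the
factor θ. -/
theorem one_le_of_quantLayer_ne_zero (hW : ∀ A B, W A B ≠ 0 → (A, B) ∈ T) (hτ : 0 < τ)
    (hξ : (T.card : ℝ) ≤ ξ) (h : quantLayer T ξ τ W ≠ 0) : 1 ≤ 4 * ξ / τ ^ 2 * frobSq W := by
  have hn : ¬ norm11 W ≤ τ / 2 := fun hn => h (by rw [quantLayer, if_pos hn])
  have h1 := norm11_sq_le hW hξ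
  have h2 : (τ / 2) ^ 2 ≤ norm11 W ^ 2 := pow_le_pow_left₀ (by positivity) (not_le.1 hn).le 2
  rw [div_mul_eq_mul_div, le_div_iff₀ (by positivity)]
  nlinarith

/-- A nonzero rounded value has modulus at least 1, so the error 1/2 is at most half of it. -/
theorem sq_round_le (x : ℝ) : ((round x : ℤ) : ℝ) ^ 2 ≤ 4 * x ^ 2 := by
  by_cases h : round x = 0
  · rw [h]
    simp only [Int.cast_zero, ne_eq, OfNat.ofNat_ne_zero, not_false_eq_true, zero_pow]
    positivity
  · have h1 := abs_sub_round x
    have h2 : (1 : ℝ) ≤ |((round x : ℤ) : ℝ)| := by exact_mod_cast Int.one_le_abs h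
    have h3 : |((round x : ℤ) : ℝ)| ≤ 2 * |x| := by
      have := abs_sub_abs_le_abs_sub ((round x : ℤ) : ℝ) x
      rw [abs_sub_comm] at this
      linarith
    have h4 := pow_le_pow_left₀ (abs_nonneg _) h3 2
    rw [mul_pow, sq_abs, sq_abs] at h4
    linarith

theorem sum_sq_quantLayer_le (hW : ∀ A B, W A B ≠ 0 → (A, B) ∈ T) :
    ∑ i, ((quantLayer T ξ τ W i : ℤ) : ℝ) ^ 2 ≤ 4 * ξ ^ 2 / τ ^ 2 * frobSq W := by
  rw [quantLayer]
  split_ifs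
  · have := frobSq_nonneg W
    simp only [Pi.zero_apply, Int.cast_zero, ne_eq, OfNat.ofNat_ne_zero, not_false_eq_true,
      zero_pow, Finset.sum_const_zero]
    positivity
  · rw [frobSq_eq_sum_pattern hW, Finset.mul_sum]
    refine Finset.sum_le_sum fun i _ => (sq_round_le _).trans (le_of_eq ?_)
    ring

end quantLayer

/-- The rounded parameters of the layers `j < L`. -/
noncomputable def quant {n : ℕ → ℕ} (L : ℕ) (S : Pattern n) (τ : ℝ) (W : Params n) :
    ∀ j : Fin L, S j → ℤ :=
  fun j => quantLayer (S j) (xiMax L S) τ (W j)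

theorem card_le_xiMax {n : ℕ → ℕ} {L : ℕ} (S : Pattern n) {j : ℕ} (hj : j < L) :
    (S j).card ≤ xiMax L S :=
  Finset.le_sup (f := fun j => (S j).card) (Finset.mem_range.2 hj)

/-- The total number of sparsity patterns below the given ones, `∑ j, 2 ^ ξ_j`. -/
noncomputable def patternCount {n : ℕ → ℕ} (L : ℕ) (S : Pattern n) : ℝ :=
  ∑ j ∈ Finset.range L, (2 : ℝ) ^ (S j).card

theorem le_patternCount {n : ℕ → ℕ} (L : ℕ) (S : Pattern n) : (L : ℝ) ≤ patternCount L S := by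
  have : ∑ _j ∈ Finset.range L, (1 : ℝ) ≤ patternCount L S :=
    Finset.sum_le_sum fun j _ => one_le_pow₀ (by norm_num)
  simpa using this

theorem two_pow_xiMax_le {n : ℕ → ℕ} {L : ℕ} (hL : 0 < L) (S : Pattern n) :
    (2 : ℝ) ^ xiMax L S ≤ patternCount L S := by
  obtain ⟨j, hj, h⟩ := Finset.exists_mem_eq_sup (Finset.range L)
    ⟨0, Finset.mem_range.2 hL⟩ fun j => (S j).card
  rw [xiMax, h]
  exact Finset.single_le_sum (f := fun j => (2 : ℝ) ^ (S j).card) (fun _ _ => by positivity) hj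

theorem norm11_sub_le_of_quant_eq {n : ℕ → ℕ} {L : ℕ} {S : Pattern n} {W V : Params n}
    (hV : DensityAdmissible L S V) (hW : DensityAdmissible L S W) {τ : ℝ} (hτ : 0 < τ)
    (hξ : 0 < xiMax L S) (h : quant L S τ V = quant L S τ W) :
    ∀ j < L, norm11 (V j - W j) ≤ τ := fun j hj =>
  norm11_sub_le_of_quantLayer_eq (hV j hj).2 (hW j hj).2 hτ (Nat.cast_pos.2 hξ)
    (Nat.cast_le.2 (card_le_xiMax S hj)) (congrFun h ⟨j, hj⟩)

theorem sq_norm11_le_totalFrobSq {n : ℕ → ℕ} {L : ℕ} {S : Pattern n} {W : Params n}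
    (hW : DensityAdmissible L S W) {j : ℕ} (hj : j < L) :
    norm11 (W j) ^ 2 ≤ xiMax L S * totalFrobSq L W := by
  refine (norm11_sq_le (hW j hj).2 (Nat.cast_le.2 (card_le_xiMax S hj))).trans ?_
  refine mul_le_mul_of_nonneg_left ?_ (Nat.cast_nonneg _)
  exact Finset.single_le_sum (f := fun j => frobSq (W j)) (fun _ _ => frobSq_nonneg _)
    (Finset.mem_range.2 hj)

/-- Nonzero layers cost `4ξΛ` and entries `8ξ²`, both times the total Frobenius term over `τ²`.
Since `2 ^ ξ` is at most the pattern count, `ξ ≤ 2Λ`, and the sum is `20 ξΛ`. -/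
theorem neg_log_latticeWeight_quant_le {n : ℕ → ℕ} {L : ℕ} (hL : 0 < L) {S : Pattern n}
    {W : Params n} (hW : DensityAdmissible L S W) {τ : ℝ} (hτ : 0 < τ) :
    -Real.log (latticeWeight (patternCount L S)⁻¹ (quant L S τ W)) ≤
      20 * (xiMax L S * Real.log (patternCount L S) * totalFrobSq L W) / τ ^ 2 := by
  have hP1 : 1 ≤ patternCount L S := le_trans (by exact_mod_cast hL) (le_patternCount L S)
  have hT : 0 ≤ totalFrobSq L W := Finset.sum_nonneg fun _ _ => frobSq_nonneg _
  set ξ : ℝ := (xiMax L S : ℝ)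
  set Λ := Real.log (patternCount L S)
  have hξ0 : 0 ≤ ξ := Nat.cast_nonneg _
  have hξΛ : ξ ≤ 2 * Λ := by
    have h1 := Real.log_le_log (by positivity) (two_pow_xiMax_le hL S)
    rw [Real.log_pow] at h1
    have := Real.log_two_gt_d9
    nlinarith
  have h := neg_log_latticeWeight_le (inv_pos.2 (by linarith)) (inv_le_one_of_one_le₀ hP1)
    (quant L S τ W) (fun j => 4 * ξ / τ ^ 2 * frobSq (W j))
    (fun j => mul_nonneg (by positivity) (frobSq_nonneg _))
    (fun j hj => one_le_of_quantLayer_ne_zero (hW j j.2).2 hτ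
      (Nat.cast_le.2 (card_le_xiMax S j.2)) hj)
  refine h.trans ?_
  have h2 : ∑ j : Fin L, ∑ i, ((quant L S τ W j i : ℤ) : ℝ) ^ 2 ≤
      4 * ξ ^ 2 / τ ^ 2 * totalFrobSq L W := by
    rw [totalFrobSq, Finset.sum_range, Finset.mul_sum]
    exact Finset.sum_le_sum fun j _ => sum_sq_quantLayer_le (hW j j.2).2
  have h3 : ∑ j : Fin L, 4 * ξ / τ ^ 2 * frobSq (W j) = 4 * ξ / τ ^ 2 * totalFrobSq L W := by
    rw [totalFrobSq, Finset.sum_range, Finset.mul_sum]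
  rw [h3, Real.log_inv, neg_neg]
  have h4 : 4 * ξ ^ 2 / τ ^ 2 * totalFrobSq L W ≤ 4 * (ξ * (2 * Λ)) / τ ^ 2 * totalFrobSq L W := by
    rw [sq ξ]
    gcongr
  calc _ ≤ Λ * (4 * ξ / τ ^ 2 * totalFrobSq L W) +
        2 * (4 * (ξ * (2 * Λ)) / τ ^ 2 * totalFrobSq L W) := by linarith
    _ = _ := by ring

/-! ### Margin losses, choice of the truncation, and the net. -/

theorem MarginError.of_abs_sub_le {X Y : Type*} {f g : X → Y → ℝ} {γ ε : ℝ} {p : X × Y}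
    (h : MarginError γ f p) (hfg : ∀ x k, |f x k - g x k| ≤ ε) : MarginError (γ + 2 * ε) g p := by
  obtain ⟨k, hk, hle⟩ := h
  have h1 := abs_le.1 (hfg p.1 p.2)
  have h2 := abs_le.1 (hfg p.1 k)
  exact ⟨k, hk, by linarith [h1.1, h2.2]⟩

theorem MarginError.mono {X Y : Type*} {f : X → Y → ℝ} {γ γ' : ℝ} {p : X × Y}
    (h : MarginError γ f p) (hγ : γ ≤ γ') : MarginError γ' f p := by
  obtain ⟨k, hk, hle⟩ := h
  exact ⟨k, hk, by linarith⟩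

theorem empMarginLoss_eq_one {X Y : Type*} {N : ℕ} (hN : 0 < N) {s : Fin N → X × Y} {γ : ℝ}
    {f : X → Y → ℝ} (h : ∀ p, MarginError γ f p) : empMarginLoss s γ f = 1 := by
  have hN' : (N : ℝ) ≠ 0 := (Nat.cast_pos.2 hN).ne'
  simp [empMarginLoss, h, hN']

theorem empMarginLoss_nonneg {X Y : Type*} {N : ℕ} (s : Fin N → X × Y) (γ : ℝ)
    (f : X → Y → ℝ) : 0 ≤ empMarginLoss s γ f :=
  div_nonneg (Finset.sum_nonneg fun _ _ => by split_ifs <;> norm_num) (Nat.cast_nonneg _)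

theorem empMarginLoss_mono {X Y : Type*} {N : ℕ} (s : Fin N → X × Y) {γ γ' : ℝ}
    {f g : X → Y → ℝ} (h : ∀ p, MarginError γ f p → MarginError γ' g p) :
    empMarginLoss s γ f ≤ empMarginLoss s γ' g := by
  refine div_le_div_of_nonneg_right (Finset.sum_le_sum fun i _ => ?_) (Nat.cast_nonneg _)
  by_cases hf : MarginError γ f (s i)
  · rw [if_pos hf, if_pos (h _ hf)]
  · rw [if_neg hf]
    split_ifs <;> norm_num

theorem empMarginLoss_eq_indicator {X Y : Type*} {N : ℕ} (s : Fin N → X × Y) (γ : ℝ)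
    (f : X → Y → ℝ) : empMarginLoss s γ f =
      (∑ k, {p | MarginError γ f p}.indicator (fun _ => (1 : ℝ)) (s k)) / N := by
  rw [empMarginLoss]
  congr 1

/-- The first layers can be dropped in such a way that the remaining layers have a large gain. -/
theorem exists_trunc {X : Type*} {n : ℕ → ℕ} {L : ℕ} {S : Pattern n}
    {ρ : X → Op (n 0)} (hρ : ∀ x, IsDensity (ρ x)) {W : Params n}
    (hW : DensityAdmissible L S W) {ε : ℝ} (hε : 0 ≤ ε) :
    ∃ J ≤ L, (∀ j, J ≤ j → j < L → ε < gain L W j) ∧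
      ∀ x k, |output L ρ W x k - output L ρ (trunc J W) x k| ≤ ε := by
  classical
  have hex : ∃ J, ∀ j, J ≤ j → j < L → ε < gain L W j := ⟨L, fun j h1 h2 => by omega⟩
  have hJL : Nat.find hex ≤ L := Nat.find_min' hex fun j h1 h2 => by omega
  refine ⟨Nat.find hex, hJL, Nat.find_spec hex, fun x k => ?_⟩
  rcases h : Nat.find hex with _ | J
  · have : trunc 0 W = W := by funext j; simp [trunc]
    rw [this, sub_self, abs_zero]
    exact hε
  · have hmin := Nat.find_min hex (m := J) (by omega)
    have hspec := Nat.find_spec hex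
    have hgain : gain L W J ≤ ε := by
      by_contra hc
      refine hmin fun j h1 h2 => ?_
      rcases Nat.eq_or_lt_of_le h1 with rfl | h3
      · exact not_le.1 hc
      · exact hspec j (by omega) h2
    exact (abs_output_sub_trunc_le hρ hW (by omega) x k).trans hgain

/-- Indices of the net: the first layer that is kept, the scale of `β`, and the rounded weights. -/
abbrev NetIdx {n : ℕ → ℕ} (L N : ℕ) (S : Pattern n) : Type :=
  Fin L × Fin (N ^ 2 + 1) × (∀ j : Fin L, S j → ℤ)

/-- The resolution of the net at scale `b` of `β`. -/
noncomputable def resolution (n : ℕ → ℕ) (L N : ℕ) (γ : ℝ) (J κ : ℕ) : ℝ :=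
  γ / (8 * (κ * ratioSum n L J / N))

open Classical in
/-- A representative of the parameters with given rounded weights. -/
noncomputable def representative {n : ℕ → ℕ} {L N : ℕ} {S : Pattern n} (γ : ℝ)
    (i : NetIdx L N S) : Params n :=
  -- The default 0 for unattained codes only serves to attach an event to every index.
  if h : ∃ V, DensityAdmissible L S V ∧ quant L S (resolution n L N γ i.1 i.2.1) V = i.2.2
  then h.choose else 0

theorem representative_spec {n : ℕ → ℕ} {L N : ℕ} {S : Pattern n} {γ : ℝ} {J : Fin L}
    {κ : Fin (N ^ 2 + 1)} {W : Params n} (hW : DensityAdmissible L S W) :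
    DensityAdmissible L S (representative γ
      (J, κ, quant L S (resolution n L N γ J κ) W)) ∧
    quant L S (resolution n L N γ J κ) (representative γ
      (J, κ, quant L S (resolution n L N γ J κ) W)) =
      quant L S (resolution n L N γ J κ) W := by
  have h : ∃ V, DensityAdmissible L S V ∧
      quant L S (resolution n L N γ J κ) V = quant L S (resolution n L N γ J κ) W := ⟨W, hW, rfl⟩
  rw [representative, dif_pos h]
  exact h.choose_spec

/-- The prior weights of the net. -/
noncomputable def netWeight {n : ℕ → ℕ} {L N : ℕ} {S : Pattern n} (i : NetIdx L N S) : ℝ :=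
  latticeWeight (patternCount L S)⁻¹ i.2.2 / (Real.exp 1 * (L * (N ^ 2 + 1)))

theorem patternCount_pos {n : ℕ → ℕ} {L : ℕ} (hL : 0 < L) (S : Pattern n) :
    0 < patternCount L S :=
  (Nat.cast_pos.2 hL).trans_le (le_patternCount L S)

theorem netWeight_pos {n : ℕ → ℕ} {L N : ℕ} (hL : 0 < L) {S : Pattern n} (i : NetIdx L N S) :
    0 < netWeight i := by
  have hL' : (0 : ℝ) < L := Nat.cast_pos.2 hL
  exact div_pos (latticeWeight_pos (inv_pos.2 (patternCount_pos hL S)) _) (by positivity)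

theorem tsum_netWeight_le {n : ℕ → ℕ} {L N : ℕ} (hL : 0 < L) (S : Pattern n) :
    ∑' i : NetIdx L N S, ENNReal.ofReal (netWeight i) ≤ 1 := by
  have hL' : (0 : ℝ) < L := Nat.cast_pos.2 hL
  have hP := patternCount_pos hL S
  have hM : 0 < Real.exp 1 * (L * ((N : ℝ) ^ 2 + 1)) := by positivity
  have h := tsum_latticeWeight_le (κ := Fin L) (ι := fun j => S j)
    (inv_pos.2 hP) (by
      simp only [Fintype.card_coe]
      rw [patternCount, Finset.sum_range]
      rw [patternCount, Finset.sum_range] at hP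
      exact (inv_mul_cancel₀ hP.ne').le)
  have hz : ∑' z : ∀ j : Fin L, S j → ℤ, ENNReal.ofReal (latticeWeight (patternCount L S)⁻¹ z /
      (Real.exp 1 * (L * ((N : ℝ) ^ 2 + 1)))) ≤ ENNReal.ofReal (1 / (L * ((N : ℝ) ^ 2 + 1))) := by
    simp only [div_eq_mul_inv (latticeWeight _ _),
      ENNReal.ofReal_mul' (inv_nonneg.2 hM.le)]
    rw [ENNReal.tsum_mul_right]
    refine (mul_le_mul_left h _).trans (le_of_eq ?_)
    rw [← ENNReal.ofReal_mul (Real.exp_nonneg 1)]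
    congr 1
    have := Real.exp_pos 1
    field_simp
  calc _ = ∑' (_ : Fin L) (_ : Fin (N ^ 2 + 1)) (z : ∀ j : Fin L, S j → ℤ),
        ENNReal.ofReal (latticeWeight (patternCount L S)⁻¹ z /
          (Real.exp 1 * (L * ((N : ℝ) ^ 2 + 1)))) := by
        rw [ENNReal.tsum_prod']
        simp only [ENNReal.tsum_prod']
        rfl
    _ ≤ ∑' (_ : Fin L) (_ : Fin (N ^ 2 + 1)), ENNReal.ofReal (1 / (L * ((N : ℝ) ^ 2 + 1))) :=
        ENNReal.tsum_le_tsum fun _ => ENNReal.tsum_le_tsum fun _ => hz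
    _ = 1 := by
        simp only [tsum_fintype, Finset.sum_const, Finset.card_univ, Fintype.card_fin,
          nsmul_eq_mul]
        rw [← ENNReal.ofReal_natCast, ← ENNReal.ofReal_natCast, ← ENNReal.ofReal_mul (by positivity),
          ← ENNReal.ofReal_mul (by positivity), ← ENNReal.ofReal_one]
        congr 1
        push_cast
        field_simp

/-- The scale `κ` of `β` for truncated parameters. -/
theorem exists_scale {n : ℕ → ℕ} {L N J : ℕ} (hN : 0 < N) (hJ : J < L) {γ : ℝ} (hγ : 0 < γ)
    (hγ1 : γ ≤ 1) (hγN : 1 ≤ γ ^ 2 * N) {W : Params n}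
    (hlow : ∀ j, J ≤ j → j < L → γ / 8 < gain L W j)
    (hup : ∀ j < L, gain L W j ^ 2 ≤ N) :
    ∃ κ : Fin (N ^ 2 + 1), beta L (trunc J W) ≤ κ * ratioSum n L J / N ∧
      0 < (κ : ℝ) * ratioSum n L J / N ∧
      (κ : ℝ) * ratioSum n L J / N ≤ 9 * beta L (trunc J W) := by
  have hN' : (1 : ℝ) ≤ N := by exact_mod_cast hN
  have hG : 0 < ratioSum n L J := ratioSum_pos n (by omega) hJ.le
  set G := ratioSum n L J
  set b := beta L (trunc J W)
  have h1 : γ / 8 * G ≤ b := mul_ratioSum_le_beta_trunc W fun j h1 h2 => by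
    rcases h2.lt_or_eq with h | rfl
    · exact (hlow j h1 h).le
    · rw [gain_self]; linarith
  have h2 : b ≤ N * G := beta_trunc_le_mul_ratioSum hJ.le W fun j h2 => by
    rcases h2.lt_or_eq with h | rfl
    · have := hup j h
      have h0 := gain_nonneg L W j
      nlinarith
    · rw [gain_self]; exact hN'
  have hb : 0 < b := lt_of_lt_of_le (by positivity) h1
  -- One grid step is `G / N`. It is at most `8b` because `b ≥ γG / 8` and `γN ≥ 1`, so rounding up
  -- to the grid loses at most the factor 9.
  have hGN : G / N ≤ 8 * b := by
    rw [div_le_iff₀ (by linarith)]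
    have hγN' : 1 ≤ γ * N := by nlinarith
    have : γ / 8 * G * N ≤ b * N := mul_le_mul_of_nonneg_right h1 (by linarith)
    nlinarith
  have hx : 0 < b * N / G := by positivity
  have hceil : ⌈b * N / G⌉₊ < N ^ 2 + 1 := by
    refine Nat.lt_succ_of_le (Nat.ceil_le.2 ?_)
    rw [div_le_iff₀ hG]
    push_cast
    nlinarith
  refine ⟨⟨⌈b * N / G⌉₊, hceil⟩, ?_, ?_, ?_⟩
  · rw [le_div_iff₀ (by linarith), ← div_le_iff₀ hG]
    exact Nat.le_ceil _
  · have : (0 : ℝ) < ⌈b * N / G⌉₊ := Nat.cast_pos.2 (Nat.ceil_pos.2 hx)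
    positivity
  · have h3 := (Nat.ceil_lt_add_one hx.le).le
    calc (⌈b * N / G⌉₊ : ℝ) * G / N ≤ (b * N / G + 1) * G / N := by gcongr
      _ = b + G / N := by field_simp
      _ ≤ _ := by linarith

theorem complexity_eq {n : ℕ → ℕ} (L : ℕ) (S : Pattern n) (W : Params n) :
    complexity L S W =
      beta L W ^ 2 * xiMax L S * Real.log (patternCount L S) * totalFrobSq L W := rfl

theorem totalFrobSq_nonneg {n : ℕ → ℕ} (L : ℕ) (W : Params n) : 0 ≤ totalFrobSq L W :=
  Finset.sum_nonneg fun _ _ => frobSq_nonneg _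

/-- Used in both directions: a gain above γ/8 forces the complexity to be at least `γ²Λ / 64`, while
a complexity small against N bounds all gains by `√N`. -/
theorem gain_sq_le {n : ℕ → ℕ} {L : ℕ} {S : Pattern n} {W : Params n}
    (hW : DensityAdmissible L S W) {j : ℕ} (hj : j < L) :
    gain L W j ^ 2 ≤ beta L W ^ 2 * xiMax L S * totalFrobSq L W := by
  have h1 := pow_le_pow_left₀ (gain_nonneg L W j) (gain_le_norm11_mul_beta W hj) 2
  rw [mul_pow] at h1
  have h2 := mul_le_mul_of_nonneg_right (sq_norm11_le_totalFrobSq hW hj) (sq_nonneg (beta L W))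
  calc _ ≤ _ := h1
    _ ≤ _ := h2
    _ = _ := by ring

/-- The cost of the net element that approximates the parameters. -/
theorem log_netWeight_le {n : ℕ → ℕ} {L N : ℕ} (hN : 0 < N) {S : Pattern n}
    {γ δ : ℝ} (hγ : 0 < γ) (hγ1 : γ ≤ 1) (hδ : 0 < δ) (hδ1 : δ ≤ 1) {W : Params n}
    (hW : DensityAdmissible L S W) (J : Fin L) (κ : Fin (N ^ 2 + 1))
    (hκ0 : 0 < (κ : ℝ) * ratioSum n L J / N)
    (hκ : (κ : ℝ) * ratioSum n L J / N ≤ 9 * beta L (trunc J W))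
    (hΛ : Real.log 2 ≤ Real.log (patternCount L S))
    (hcomp : γ ^ 2 * Real.log (patternCount L S) ≤ 64 * complexity L S W)
    (hδN : 0 ≤ Real.log (N / δ)) :
    Real.log (1 / (netWeight (N := N) (J, κ, quant L S (resolution n L N γ J κ) (trunc J W)) * δ)) ≤
      104000 * (complexity L S W + Real.log (N / δ)) / γ ^ 2 := by
  have hL : 0 < L := J.pos
  have hL' : (1 : ℝ) ≤ L := by exact_mod_cast hL
  have hN' : (1 : ℝ) ≤ N := by exact_mod_cast hN
  have hP := patternCount_pos hL S
  have hlogL : Real.log L ≤ Real.log (patternCount L S) :=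
    Real.log_le_log (by linarith) (le_patternCount L S)
  have hlogN : Real.log ((N : ℝ) ^ 2 + 1) ≤ Real.log 2 + 2 * Real.log N := by
    have : Real.log ((N : ℝ) ^ 2 + 1) ≤ Real.log (2 * (N : ℝ) ^ 2) :=
      Real.log_le_log (by positivity) (by nlinarith)
    rwa [Real.log_mul (by norm_num) (by positivity), Real.log_pow, Nat.cast_ofNat] at this
  have hlogN0 : 0 ≤ Real.log N := Real.log_nonneg hN'
  set b := (κ : ℝ) * ratioSum n L J / N with hb
  set Λ := Real.log (patternCount L S)
  set τ := resolution n L N γ J κ with hτdef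
  set A := complexity L S W with hA
  have hτ' : τ = γ / (8 * b) := rfl
  have hτ : 0 < τ := by rw [hτ']; positivity
  have hlat := latticeWeight_pos (inv_pos.2 hP) (quant L S τ (trunc J W))
  have hcost := neg_log_latticeWeight_quant_le hL (hW.trunc (J : ℕ)) hτ
  have hΛ2 : 1 / 2 ≤ Λ := by have := Real.log_two_gt_d9; linarith
  -- The constant is `20 · 8² · 9²`: the rounding cost, the 8 in the resolution and the factor 9 of
  -- the scale.
  have hcost2 : -Real.log (latticeWeight (patternCount L S)⁻¹ (quant L S τ (trunc J W))) ≤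
      103680 * A / γ ^ 2 := by
    refine hcost.trans ?_
    have h1 : (xiMax L S : ℝ) * Λ * totalFrobSq L (trunc J W) ≤
        xiMax L S * Λ * totalFrobSq L W :=
      mul_le_mul_of_nonneg_left (totalFrobSq_trunc_le L J W) (by positivity)
    have h2 : b ≤ 9 * beta L W := hκ.trans (by linarith [beta_trunc_le L J W])
    have h3 : b ^ 2 ≤ (9 * beta L W) ^ 2 := pow_le_pow_left₀ hκ0.le h2 2
    have h4 : 0 ≤ (xiMax L S : ℝ) * Λ * totalFrobSq L W :=
      mul_nonneg (by positivity) (totalFrobSq_nonneg L W)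
    calc 20 * (xiMax L S * Λ * totalFrobSq L (trunc J W)) / τ ^ 2
        ≤ 20 * (xiMax L S * Λ * totalFrobSq L W) / τ ^ 2 := by gcongr
      _ = 1280 * ((xiMax L S * Λ * totalFrobSq L W) * b ^ 2) / γ ^ 2 := by
          rw [hτ']; field_simp; ring
      _ ≤ 1280 * ((xiMax L S * Λ * totalFrobSq L W) * (9 * beta L W) ^ 2) / γ ^ 2 := by gcongr
      _ = 103680 * A / γ ^ 2 := by rw [hA, complexity_eq]; ring
  have hsplit : Real.log (1 / (netWeight (N := N) (J, κ, quant L S τ (trunc J W)) * δ)) =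
      -Real.log (latticeWeight (patternCount L S)⁻¹ (quant L S τ (trunc J W))) + 1 + Real.log L +
        Real.log ((N : ℝ) ^ 2 + 1) - Real.log δ := by
    rw [netWeight, one_div, Real.log_inv, Real.log_mul (by positivity) hδ.ne',
      Real.log_div hlat.ne' (by positivity), Real.log_mul (Real.exp_pos 1).ne' (by positivity),
      Real.log_mul (by positivity) (by positivity), Real.log_exp]
    ring
  rw [Real.log_div (by positivity) hδ.ne'] at hδN ⊢
  rw [hsplit]
  have hγ2 : γ ^ 2 ≤ 1 := pow_le_one₀ hγ.le hγ1
  have hΛA : Λ ≤ 64 * A / γ ^ 2 := by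
    rw [le_div_iff₀ (by positivity)]; linarith
  have hA0 : 0 ≤ A := by
    have : 0 ≤ γ ^ 2 * Λ := by positivity
    linarith
  have hu : Real.log N - Real.log δ ≤ (Real.log N - Real.log δ) / γ ^ 2 :=
    le_div_self hδN (by positivity) hγ2
  have hX : 0 ≤ A / γ ^ 2 := by positivity
  have hU : 0 ≤ (Real.log N - Real.log δ) / γ ^ 2 := by positivity
  rw [mul_div_assoc] at hΛA hcost2
  rw [mul_div_assoc, add_div]
  have hlogδ : Real.log δ ≤ 0 := Real.log_nonpos hδ.le hδ1
  -- The remaining terms are at most `4Λ + 2 log (N / δ)`, and `4Λ ≤ 256 A / γ²` fits between 103680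
  -- and 104000.
  linarith

theorem sqrt_div_le_of_le {x A u v γ N : ℝ} (hγ : 0 < γ) (hN : 0 < N)
    (hx : x ≤ 104000 * (A + u) / γ ^ 2) (huv : u ≤ v) (hA : 0 ≤ A + v) :
    √(x / (2 * N)) ≤ 1000 * √((A + v) / (γ ^ 2 * N)) := by
  rw [show (1000 : ℝ) * √((A + v) / (γ ^ 2 * N)) = √(1000 ^ 2 * ((A + v) / (γ ^ 2 * N))) by
    rw [Real.sqrt_mul (by positivity), Real.sqrt_sq (by norm_num)]]
  refine Real.sqrt_le_sqrt ?_
  have hQ : 0 ≤ (A + v) / (γ ^ 2 * N) := by positivity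
  have h1 : 104000 * (A + u) / γ ^ 2 ≤ 104000 * (A + v) / γ ^ 2 := by gcongr
  calc x / (2 * N) ≤ 104000 * (A + v) / γ ^ 2 / (2 * N) := by
        gcongr
        exact hx.trans h1
    _ = 52000 * ((A + v) / (γ ^ 2 * N)) := by field_simp; ring
    _ ≤ _ := by linarith

/-! ### The deterministic margin bound and the conclusion. -/

/-- The margin bound holds for all samples for which the frequencies of the margin errors of the
net are close to their probabilities. -/
theorem marginLoss_le_of_forall_net {X : Type*} [MeasurableSpace X] {L : ℕ} (hL : 0 < L)
    {n : ℕ → ℕ} {S : Pattern n} {ρ : X → Op (n 0)} (hρ : ∀ x, IsDensity (ρ x))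
    (D : Measure (X × Bits (n L))) [IsProbabilityMeasure D] {N : ℕ} (hN : 0 < N) {γ : ℝ}
    (hγ : 0 < γ) {δ : ℝ} (hδ : 0 < δ) (hδ1 : δ ≤ 1) (s : Fin N → X × Bits (n L))
    (hs : ∀ i : NetIdx L N S, marginLoss D (γ / 2) (output L ρ (representative γ i)) ≤
      empMarginLoss s (γ / 2) (output L ρ (representative γ i)) +
        √(Real.log (1 / (netWeight i * δ)) / (2 * N)))
    {W : Params n} (hW : DensityAdmissible L S W) {M : ℝ} (hM : 1 ≤ M) :
    marginLoss D 0 (output L ρ W) ≤ empMarginLoss s γ (output L ρ W) +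
      1000 * √((complexity L S W + Real.log (N * M / δ)) / (γ ^ 2 * N)) := by
  have hN' : (1 : ℝ) ≤ N := by exact_mod_cast hN
  set A := complexity L S W with hA
  set Q := (A + Real.log (N * M / δ)) / (γ ^ 2 * N) with hQ
  have hloss : marginLoss D 0 (output L ρ W) ≤ 1 := measureReal_le_one
  have hemp0 := empMarginLoss_nonneg s γ (output L ρ W)
  have hsq0 : 0 ≤ 1000 * √Q := by positivity
  have htriv : (∀ p, MarginError γ (output L ρ W) p) → marginLoss D 0 (output L ρ W) ≤
      empMarginLoss s γ (output L ρ W) + 1000 * √Q := fun h => by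
    rw [empMarginLoss_eq_one hN h]; linarith
  by_cases hK : Subsingleton (Bits (n L))
  · have : marginLoss D 0 (output L ρ W) = 0 := by
      have : {p | MarginError 0 (output L ρ W) p} = (∅ : Set (X × Bits (n L))) := by
        ext p
        exact ⟨fun ⟨k, hk, _⟩ => hk (Subsingleton.elim _ _), fun h => h.elim⟩
      rw [marginLoss, this, measureReal_empty]
    linarith
  have hKn : Nontrivial (Bits (n L)) := not_subsingleton_iff_nontrivial.1 hK
  by_cases hγ1 : 1 < γ
  · refine htriv fun p => ?_
    obtain ⟨k, hk⟩ := exists_ne p.2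
    exact ⟨k, hk, by linarith [(output_mem_Icc hρ hW p.1 p.2).2, (output_mem_Icc hρ hW p.1 k).1]⟩
  have hγ1 : γ ≤ 1 := not_lt.1 hγ1
  -- A right-hand side of at least 1 needs no proof. The opposite case makes `Q` tiny, which later
  -- yields `γ² N ≥ 1` and the upper bound on the gains.
  by_cases hbig : 1 ≤ 1000 * √Q
  · linarith
  obtain ⟨J, hJL, hlow, hclose⟩ := exists_trunc hρ hW (ε := γ / 8) (by positivity)
  rcases hJL.eq_or_lt with rfl | hJ
  -- If every layer is dropped, the outputs are within γ/8 of a function that is constant over the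
  -- classes, so every example is a margin error.
  · refine htriv fun p => ?_
    obtain ⟨k, hk⟩ := exists_ne p.2
    have h1 := abs_le.1 (hclose p.1 p.2)
    have h2 := abs_le.1 (hclose p.1 k)
    have h3 := output_trunc_self hL hρ hW p.1 p.2 k
    exact ⟨k, hk, by linarith [h1.2, h2.1]⟩
  have hQ1 : Q < 1 / 1000000 := by
    rcases le_or_gt Q 0 with h | h
    · linarith
    · have h1 : √Q < 1 / 1000 := by linarith
      have := Real.sq_sqrt h.le
      nlinarith [Real.sqrt_nonneg Q]
  have hNδ1 : 1 ≤ N / δ := by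
    rw [le_div_iff₀ hδ]; linarith
  have hlogNδ : 0 ≤ Real.log (N / δ) := Real.log_nonneg hNδ1
  have hlogM : Real.log (N / δ) ≤ Real.log (N * M / δ) := by
    refine Real.log_le_log (by linarith) ?_
    gcongr
    exact le_mul_of_one_le_right (by linarith) hM
  have hgainL : γ / 8 < gain L W (L - 1) := hlow _ (by omega) (by omega)
  have hgainsq := gain_sq_le hW (j := L - 1) (by omega)
  have hpos : γ ^ 2 / 64 < beta L W ^ 2 * xiMax L S * totalFrobSq L W := by
    refine lt_of_lt_of_le ?_ hgainsq
    nlinarith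
  have hξ : 0 < xiMax L S := by
    rcases Nat.eq_zero_or_pos (xiMax L S) with h | h
    · rw [h, Nat.cast_zero, mul_zero, zero_mul] at hpos
      have : 0 < γ ^ 2 / 64 := by positivity
      linarith
    · exact h
  have hΛ : Real.log 2 ≤ Real.log (patternCount L S) := by
    refine Real.log_le_log (by norm_num) (le_trans ?_ (two_pow_xiMax_le hL S))
    exact le_self_pow₀ (by norm_num) hξ.ne'
  have hlog2 : 1 / 2 ≤ Real.log 2 := by have := Real.log_two_gt_d9; linarith
  have hAeq : A = beta L W ^ 2 * xiMax L S * totalFrobSq L W * Real.log (patternCount L S) := by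
    rw [hA, complexity_eq]; ring
  set B := beta L W ^ 2 * xiMax L S * totalFrobSq L W
  set Λ := Real.log (patternCount L S)
  have hΛ0 : 1 / 2 ≤ Λ := hlog2.trans hΛ
  have hγ2 : 0 < γ ^ 2 := by positivity
  have hcomp : γ ^ 2 * Λ ≤ 64 * A := by rw [hAeq]; nlinarith
  have hA0 : 0 ≤ A := by nlinarith
  have hden : 0 < γ ^ 2 * N := by positivity
  have hQ2 : A + Real.log (N * M / δ) < γ ^ 2 * N / 1000000 := by
    rw [hQ, div_lt_iff₀ hden] at hQ1
    linarith
  have hγ21 : γ ^ 2 ≤ 1 := pow_le_one₀ hγ.le hγ1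
  have hγN : 1 ≤ γ ^ 2 * N := by
    -- For N = 1 the term `log (N / δ)` may be arbitrarily small; there the lower bound on the
    -- complexity contradicts the smallness of `Q`. For N ≥ 2 the logarithm is at least `log 2`.
    rcases Nat.eq_or_lt_of_le (Nat.succ_le_of_lt hN) with h | h
    · have hN1 : (N : ℝ) = 1 := by rw [← h]; norm_num
      rw [hN1, mul_one] at hQ2
      have : Real.log (N / δ) ≤ Real.log (N * M / δ) := hlogM
      rw [hN1] at this hlogNδ
      rw [one_mul] at hQ2
      rw [one_mul] at this
      nlinarith
    · have h2 : (2 : ℝ) ≤ N := by exact_mod_cast h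
      have h3 : Real.log 2 ≤ Real.log (N / δ) := by
        refine Real.log_le_log (by norm_num) ?_
        rw [le_div_iff₀ hδ]
        nlinarith
      linarith
  have hup : ∀ j < L, gain L W j ^ 2 ≤ N := fun j hj => by
    refine (gain_sq_le hW hj).trans ?_
    change B ≤ N
    have hB0 : 0 < B := lt_trans (by positivity) hpos
    have : B * Λ ≤ N := by
      rw [← hAeq]
      nlinarith
    nlinarith
  obtain ⟨κ, hκ1, hκ0, hκ9⟩ := exists_scale hN hJ hγ hγ1 hγN hlow hup
  have hcost := log_netWeight_le hN hγ hγ1 hδ hδ1 hW ⟨J, hJ⟩ κ hκ0 hκ9 hΛ hcomp hlogNδ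
  obtain ⟨hV, hVq⟩ := representative_spec (N := N) (γ := γ) (J := ⟨J, hJ⟩) (κ := κ)
    (hW.trunc J)
  have hnet := hs (⟨J, hJ⟩, κ, quant L S (resolution n L N γ J κ) (trunc J W))
  set V := representative γ ((⟨J, hJ⟩ : Fin L), κ,
    quant L S (resolution n L N γ J κ) (trunc J W))
  have hτ : 0 < resolution n L N γ J κ := div_pos hγ (by positivity)
  have hdist := norm11_sub_le_of_quant_eq hV (hW.trunc J) hτ hξ hVq
  -- Truncation and rounding cost γ/8 each. A uniform error of γ/4 shifts margins by γ/2, so the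
  -- levels are 0 for `W`, γ/2 for the representative and γ for `W` again.
  have hWV : ∀ x k, |output L ρ W x k - output L ρ V x k| ≤ γ / 4 := fun x k => by
    have h1 := hclose x k
    have h2 := abs_output_sub_le_mul_beta hL hρ (hW.trunc J) hV hdist x k
    have h3 : resolution n L N γ J κ * beta L (trunc J W) ≤ γ / 8 := by
      refine (mul_le_mul_of_nonneg_left hκ1 hτ.le).trans (le_of_eq ?_)
      rw [resolution]
      generalize (κ : ℝ) * ratioSum n L J / N = b at hκ0
      field_simp
    have h4 := abs_sub_le (output L ρ W x k) (output L ρ (trunc J W) x k) (output L ρ V x k)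
    linarith
  have hL0 : marginLoss D 0 (output L ρ W) ≤ marginLoss D (γ / 2) (output L ρ V) :=
    measureReal_mono fun p hp => by
      have h : MarginError 0 (output L ρ W) p := hp
      exact (h.of_abs_sub_le hWV).mono (by linarith)
  have hLe : empMarginLoss s (γ / 2) (output L ρ V) ≤ empMarginLoss s γ (output L ρ W) :=
    empMarginLoss_mono s fun p h =>
      (h.of_abs_sub_le (fun x k => by rw [abs_sub_comm]; exact hWV x k)).mono (by linarith)
  have hroot := sqrt_div_le_of_le hγ (by linarith : (0 : ℝ) < N) hcost hlogM (by linarith)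
  exact hL0.trans (hnet.trans (add_le_add hLe hroot))

end PTMModel

/-- One absolute constant `c` serves all models, distributions, sample sizes, margins and
confidence levels. The failure event may be non-measurable: its outer measure is at most `δ`. -/
theorem mainTheorem2 :
    ∃ c : ℝ, 0 < c ∧
      ∀ (X : Type*) [MeasurableSpace X] (L : ℕ) (_ : 0 < L) (n : ℕ → ℕ)
        (S : PTMModel.Pattern n)
        (ρ : X → PTMModel.Op (n 0)) (_ : ∀ x, PTMModel.IsDensity (ρ x))
        (_ : ∀ a b, Measurable fun x => ρ x a b)
        (D : Measure (X × PTMModel.Bits (n L))) [IsProbabilityMeasure D]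
        (N : ℕ) (_ : 0 < N) (γ : ℝ) (_ : 0 < γ) (δ : ℝ) (_ : 0 < δ) (_ : δ < 1),
        Measure.pi (fun _ : Fin N => D)
          {s | ∀ W : PTMModel.Params n, PTMModel.Admissible L S W →
            ∀ C : ℕ → ℝ, (∀ l < L, PTMModel.norm11 (W l) ≤ C l) →
              PTMModel.marginLoss D 0 (PTMModel.output L ρ W) ≤
                PTMModel.empMarginLoss s γ (PTMModel.output L ρ W) +
                  c * √((PTMModel.complexity L S W +
                    Real.log (N * PTMModel.netSize L N γ W C / δ)) / (γ ^ 2 * N))}ᶜ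
          ≤ ENNReal.ofReal δ := by
  refine ⟨1000, by norm_num, ?_⟩
  intro X _ L hL n S ρ hρ hmeas D _ N hN γ hγ δ hδ hδ1
  -- Only the countably many fixed representatives have to give measurable events; the failure set
  -- over all parameters is merely contained in their union.
  refine (measure_mono fun s hs => ?_).trans
    (PTMModel.measure_pi_exists_freq_lt_le D
      (E := fun i : PTMModel.NetIdx L N S => {p | PTMModel.MarginError (γ / 2)
        (PTMModel.output L ρ (PTMModel.representative γ i)) p})
      (fun i => PTMModel.measurableSet_marginError
        (fun k => PTMModel.measurable_output hmeas _ k) _)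
      (PTMModel.netWeight_pos hL) (PTMModel.tsum_netWeight_le hL S) hN hδ hδ1.le)
  by_contra hc
  refine hs fun W hW C _ => ?_
  refine PTMModel.marginLoss_le_of_forall_net hL hρ D hN hγ hδ hδ1.le s (fun i => ?_)
    hW.densityAdmissible (le_max_left _ _)
  by_contra hi
  refine hc ⟨i, ?_⟩
  rw [← PTMModel.empMarginLoss_eq_indicator]
  exact not_le.1 hi
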